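/- Let $T\ge 1$ and let $X_0,\dots,X_{T-1}$ be random vectors with values in a set $\mathsf X\subset\mathbb R^{d_X}$, with joint law $\mathsf P_X$. Let $\mathscr F$ be a class of functions $\mathbb R^{d_X}\to\mathbb R^{d_Y}$ that are measurable on $\mathsf X$, let $f_\star\in\mathscr F$, and put $\mathscr F_\star=\{f-f_\star : f\in\mathscr F\}$. Write $\|f\|_{L^p}^p=\frac1T\sum_{t=0}^{T-1}\mathbf E\|f(X_t)\|_2^p$ and $\|f\|_\infty=\sup_{x\in\mathsf X}\|f(x)\|_2$, and assume that $\|f\|_{L^2}<\infty$ for all $f\in\mathscr F_\star$. For $r>0$ let $B(r)=\{f\in\mathscr F_\star:\|f\|_{L^2}\le r\}$ and $\partial B(r)=\{f\in\mathscr F_\star:\|f\|_{L^2}=r\}$. The dependency matrix $\Gamma_{\mathsf{dep}}(\mathsf P_X)=(\Gamma_{ij})_{i,j=0}^{T-1}$ is defined by $\Gamma_{ii}=1$, $\Gamma_{ij}=0$ for $i>j$, and, for $i<j$, $$\Gamma_{ij}=\sqrt{2\,\sup_{A}\ \big\|\mathbf P\big((X_j,\dots,X_{T-1})\in\cdot \mid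 A\big)-\mathbf P\big((X_j,\dots,X_{T-1})\in\cdot\big)\big\|_{\mathrm{TV}}},$$ where $A$ ranges over the events of positive probability in the $\sigma$-algebra generated by $X_0,\dots,X_i$ and $\|\mu-\nu\|_{\mathrm{TV}}=\sup_{B}|\mu(B)-\nu(B)|$. Let $\|\cdot\|_{\mathrm{op}}$ denote the largest singular value of a matrix. **Theorem (lower isometry).** Fix $\alpha\in[1,2]$ and $C,r>0$. Suppose that $\mathscr F_\star$ is star-shaped, i.e. $\gamma f\in\mathscr F_\star$ for all $f\in\mathscr F_\star$ and $\gamma\in[0,1]$. Let $\mathscr F_r\subset\partial B(r)$ be an $r/\sqrt8$-net of $\partial B(r)$ in $\|\cdot\|_\infty$, i.e. for every $f\in\partial B(r)$ there is $g\in\mathscr F_r$ with $\|f-g\|_\infty\le r/\sqrt8$, and suppose that $(\mathscr F_r,\mathsf P_X)$ is trajectory $(C,\alpha)$-hypercontractive, i.e. $$\frac1T\sum_{t=0}^{T-1}\mathbf E\|f(X_t)\|_2^4\le C\Big(\frac1T\sum_{t=0}^{T-1}\mathbf E\|f(X_t)\|_2^2\Big)^{\alpha}\qquad\text{for all } f\in\mathscr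 F_r .$$ Then $$\mathbf P\left(\exists f\in\mathscr F_\star\setminus B(r):\ \frac1T\sum_{t=0}^{T-1}\|f(X_t)\|_2^2\le\frac18\cdot\frac1T\sum_{t=0}^{T-1}\mathbf E\|f(X_t)\|_2^2\right)\le|\mathscr F_r|\exp\left(\frac{-T\,r^{4-2\alpha}}{8C\,\|\Gamma_{\mathsf{dep}}(\mathsf P_X)\|_{\mathrm{op}}^2}\right).$$ (If the event on the left is not measurable, $\mathbf P$ denotes outer probability; if $\mathscr F_r$ is infinite, the right-hand side is $+\infty$.) -/

import Mathlib

open MeasureTheory ProbabilityTheory Set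
open scoped ENNReal Pointwise

noncomputable section

namespace LowerIsometry

/-- Total variation distance `sup_B |μ(B) - ν(B)|` over measurable sets `B`. -/
def tvDist {S : Type*} [MeasurableSpace S] (μ ν : Measure S) : ℝ :=
  sSup {d : ℝ | ∃ B : Set S, MeasurableSet B ∧ d = |μ.real B - ν.real B|}

/-- The past `(z_0, …, z_i)` of a trajectory. -/
def past {T : ℕ} {S : Type*} (i : Fin T) (z : Fin T → S) : Set.Iic i → S := fun t => z t

/-- The future `(z_j, …, z_{T-1})` of a trajectory. -/
def future {T : ℕ} {S : Type*} (j : Fin T) (z : Fin T → S) : Set.Ici j → S := fun t => z t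

/-- `sup_A ‖P_{Z_{j:T-1}}(· | A) - P_{Z_{j:T-1}}‖_TV`, for the coordinate process `Z` on the path
space with law `P`; the supremum is over the events `A` of the σ-algebra generated by
`Z_0, …, Z_i` on which one can condition, that is, those of positive probability. -/
def depCoeff {T : ℕ} {S : Type*} [MeasurableSpace S] (P : Measure (Fin T → S))
    (i j : Fin T) : ℝ :=
  sSup {d : ℝ | ∃ A : Set (Fin T → S),
    MeasurableSet[MeasurableSpace.comap (past i) inferInstance] A ∧ P A ≠ 0 ∧
      d = tvDist ((P[|A]).map (future j)) (P.map (future j))}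

/-- The (upper triangular) dependency matrix of a process with law `P` on the path space. -/
def depMatrix {T : ℕ} {S : Type*} [MeasurableSpace S] (P : Measure (Fin T → S)) :
    Matrix (Fin T) (Fin T) ℝ :=
  Matrix.of fun i j => if i < j then √(2 * depCoeff P i j) else if i = j then 1 else 0

/-- The operator norm (largest singular value) of a real square matrix. -/
def opNorm {n : ℕ} (M : Matrix (Fin n) (Fin n) ℝ) : ℝ :=
  ‖Matrix.toEuclideanCLM (n := Fin n) (𝕜 := ℝ) M‖

/-- `‖f‖_∞ = sup_{x ∈ 𝒳} ‖f x‖`, possibly infinite. -/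
def supNorm {D E : Type*} [NormedAddCommGroup E] (𝒳 : Set D) (f : D → E) : ℝ≥0∞ :=
  ⨆ x ∈ 𝒳, ‖f x‖ₑ

/-- `N` is an `ε`-net of `S` in the norm `‖·‖_∞`; the points of a net of `S` belong to `S`. -/
def IsSupNet {D E : Type*} [NormedAddCommGroup E] (𝒳 : Set D) (ε : ℝ) (S N : Set (D → E)) :
    Prop :=
  N ⊆ S ∧ ∀ f ∈ S, ∃ g ∈ N, supNorm 𝒳 (f - g) ≤ ENNReal.ofReal ε

section Trajectory

variable {Ω D E : Type*} [NormedAddCommGroup E] {T : ℕ}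

/-- The empirical squared norm `(1/T) ∑_t ‖f(X_t)‖²` at the outcome `ω`. -/
def empSq (X : Fin T → Ω → D) (f : D → E) (ω : Ω) : ℝ≥0∞ :=
  (T : ℝ≥0∞)⁻¹ * ∑ t, ‖f (X t ω)‖ₑ ^ 2

variable [MeasurableSpace Ω]

/-- `‖f‖_{L^p}^p = (1/T) ∑_t 𝔼 ‖f(X_t)‖^p`, possibly infinite. -/
def moment (μ : Measure Ω) (X : Fin T → Ω → D) (p : ℕ) (f : D → E) : ℝ≥0∞ :=
  (T : ℝ≥0∞)⁻¹ * ∑ t, ∫⁻ ω, ‖f (X t ω)‖ₑ ^ p ∂μ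

/-- The closed `L²` ball `B(r)` of the class `G`. -/
def ball (μ : Measure Ω) (X : Fin T → Ω → D) (G : Set (D → E)) (r : ℝ) : Set (D → E) :=
  {f ∈ G | moment μ X 2 f ≤ ENNReal.ofReal (r ^ 2)}

/-- The boundary `∂B(r)` of the `L²` ball of the class `G`. -/
def sphere (μ : Measure Ω) (X : Fin T → Ω → D) (G : Set (D → E)) (r : ℝ) : Set (D → E) :=
  {f ∈ G | moment μ X 2 f = ENNReal.ofReal (r ^ 2)}

/-- Trajectory `(C, α)`-hypercontractivity of the class `G`. -/
def Hypercontractive (μ : Measure Ω) (X : Fin T → Ω → D) (G : Set (D → E)) (C α : ℝ) : Prop :=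
  ∀ f ∈ G, moment μ X 4 f ≤ ENNReal.ofReal C * (moment μ X 2 f) ^ α

end Trajectory

end LowerIsometry

end

/-!
The statement reduces to a lower-tail estimate for a single function of the net: a function outside
the ball is rescaled to the sphere by star-shapedness (`exists_mem_sphere_empSq_le`), replaced by a
point `g` of the net (`empSq_le_of_supNorm_le`), and the events
`(1/T) ∑ ‖g (X_t)‖² ≤ r² / 2` are summed over the net (`measure_empSq_le_half_le_exp`).

For one function, with `g ≥ 0` now standing for its squared norm, the estimate is Chernoff's bound
with the Laplace transform
`𝔼 exp (-s ∑ g (X_t)) ≤ exp (-s ∑ 𝔼 g (X_t) + s² ‖Γ‖² ∑ 𝔼 g (X_t)² / 2)`, which is dual to an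
asymmetric transport–entropy inequality (`sum_integral_mul_one_sub_le`): for every change of
measure with density `ρ`,
`∑ 𝔼 [g (X_t) (1 - ρ)] ≤ ‖Γ‖ √(∑ 𝔼 g (X_t)²) √(2 𝔼 [ρ log ρ])`.

Couplings of conditional laws are avoided: everything is expressed through the density martingale
`ρ_n = 𝔼[ρ | X_0, …, X_{n-1}]`. With `E_n = 𝔼 [(ρ_n - ρ_{n+1})₊² / ρ_n]`, three facts carry the proof.

* The chain rule for relative entropy and `(1 - u)₊² ≤ 2 (u log u - u + 1)` give
  `∑ E_n ≤ 2 𝔼 [ρ log ρ]` (`sum_incrementEnergy_le`).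
* For fixed `j` let `m_n = 𝔼[ρ_n | X_j]` be the density of the law of `X_j` after `n` steps, and
  `θ_n = (1 - m_{n+1} / m_n)₊`. Since `1 - m_T ≤ ∑ min (1, m_n) θ_n` and `min (1, m_n)² ≤ m_n`, the
  Cauchy–Schwarz inequality leaves the second moment of `g (X_j)` under the original law times
  `𝔼 [m_n θ_n²]` (`integral_mul_one_sub_le_sum`).
* `𝔼 [m_n θ_n²] = 𝔼 [(ρ_n - ρ_{n+1}) θ_n] ≤ Γ_{nj}² E_n`
  (`integral_mul_sq_le_of_mixingBound`). Here `θ_n` may be replaced by its conditional expectation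
  given `X_0, …, X_n` minus any function of `X_0, …, X_{n-1}`. For a suitable choice of the latter,
  a constant when `n < j`, mixing bounds the square of that difference by `Γ_{nj}²` times the
  conditional second moment of `θ_n` (`mixingBound_depMatrix`).
-/

namespace LowerIsometry

/-! ### Scalar inequalities -/

lemma one_sub_le_sum_min_mul {m : ℕ → ℝ} (h0 : m 0 = 1) (hpos : ∀ n, 0 < m n) (T : ℕ) :
    1 - m T ≤ ∑ n ∈ Finset.range T, min 1 (m n) * max 0 (1 - m (n + 1) / m n) := by
  have key : ∀ n, min 1 (m n) - min 1 (m (n + 1)) ≤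
      min 1 (m n) * max 0 (1 - m (n + 1) / m n) := by
    intro n
    have h1 := hpos n
    have h2 := hpos (n + 1)
    have hnn : 0 ≤ min 1 (m n) * max 0 (1 - m (n + 1) / m n) := by positivity
    rcases le_or_gt (min 1 (m n)) (m (n + 1)) with h | h
    · have : min 1 (m n) ≤ min 1 (m (n + 1)) := le_min (min_le_left _ _) h
      linarith
    · have h3 : min 1 (m (n + 1)) = m (n + 1) :=
        min_eq_right (h.le.trans (min_le_left _ _))
      have h4 : m (n + 1) / m n ≤ 1 := (div_le_one h1).2 (h.le.trans (min_le_right _ _))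
      rw [h3, max_eq_right (by linarith), mul_sub, mul_one]
      have : min 1 (m n) * (m (n + 1) / m n) ≤ m n * (m (n + 1) / m n) :=
        mul_le_mul_of_nonneg_right (min_le_right _ _) (by positivity)
      rw [mul_div_cancel₀ _ h1.ne'] at this
      linarith
  calc 1 - m T ≤ min 1 (m 0) - min 1 (m T) := by
        rw [h0, min_self]; linarith [min_le_right 1 (m T)]
    _ = ∑ n ∈ Finset.range T, (min 1 (m n) - min 1 (m (n + 1))) :=
        (Finset.sum_range_sub' (fun n => min 1 (m n)) T).symm
    _ ≤ _ := Finset.sum_le_sum fun n _ => key n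

/-- The quadratic lower bound for relative entropy on its left tail. It comes from `u ≤ sinh u`
at `u = log (a / b)`. -/
lemma sq_posPart_sub_div_le {a b : ℝ} (ha : 0 < a) (hb : 0 < b) :
    (max (a - b) 0) ^ 2 / a ≤ 2 * (b * Real.log b - b * Real.log a - b + a) := by
  rcases le_or_gt a b with h | h
  · rw [max_eq_right (by linarith)]
    have h1 := Real.log_le_sub_one_of_pos (div_pos ha hb)
    rw [Real.log_div ha.ne' hb.ne'] at h1
    have h2 : b * (Real.log a - Real.log b) ≤ b * (a / b - 1) :=
      mul_le_mul_of_nonneg_left h1 hb.le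
    rw [mul_sub b (a / b), mul_div_cancel₀ _ hb.ne'] at h2
    have : (0 : ℝ) ^ 2 / a = 0 := by simp
    rw [this]
    linarith
  · rw [max_eq_left (by linarith)]
    have h0 : 0 ≤ Real.log (a / b) := Real.log_nonneg ((one_le_div hb).2 h.le)
    have h1 := Real.self_le_sinh_iff.2 h0
    rw [Real.sinh_log (div_pos ha hb), Real.log_div ha.ne' hb.ne', inv_div] at h1
    have h2 : b * (Real.log a - Real.log b) ≤ b * ((a / b - b / a) / 2) :=
      mul_le_mul_of_nonneg_left h1 hb.le
    have h3 : b * ((a / b - b / a) / 2) = (a - b ^ 2 / a) / 2 := by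
      field_simp
    have h4 : (a - b) ^ 2 / a = a - 2 * b + b ^ 2 / a := by
      field_simp; ring
    rw [h4]
    linarith

/-- A quadratic that is nonnegative at all positive arguments yields a bound on its
discriminant. -/
lemma sq_le_mul_of_forall_le {x δ p : ℝ} (hx : 0 ≤ x) (hδ : 0 ≤ δ) (hp : 0 ≤ p)
    (h : ∀ q : ℚ, 0 < q → x ≤ δ * (q : ℝ) / 2 + p / (2 * q)) : x ^ 2 ≤ δ * p := by
  have h1 : ∀ s : ℝ, 0 ≤ δ * (s * s) + (-(2 * x)) * s + p := by
    intro s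
    refine Rat.denseRange_cast.induction_on
      (p := fun s : ℝ => 0 ≤ δ * (s * s) + (-(2 * x)) * s + p) s ?_ ?_
    · exact isClosed_le continuous_const (by fun_prop)
    · intro q
      rcases le_or_gt q 0 with hq | hq
      · have hq' : (q : ℝ) ≤ 0 := by exact_mod_cast hq
        have : 0 ≤ δ * ((q : ℝ) * q) := mul_nonneg hδ (mul_self_nonneg _)
        nlinarith [mul_nonneg hx (neg_nonneg.2 hq')]
      · have hq' : (0 : ℝ) < q := by exact_mod_cast hq
        have h2 := mul_le_mul_of_nonneg_right (h q hq) (by positivity : (0 : ℝ) ≤ 2 * q)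
        have h3 : (δ * (q : ℝ) / 2 + p / (2 * q)) * (2 * q) = δ * (q * q) + p := by
          field_simp
        rw [h3] at h2
        linarith
  have h2 := discrim_le_zero h1
  rw [discrim] at h2
  nlinarith

/-! ### Integration against conditional expectations -/

section CondExp

variable {Ω : Type*} {m : MeasurableSpace Ω} [mΩ : MeasurableSpace Ω] {P : Measure Ω}
  [IsProbabilityMeasure P]

lemma integrable_of_abs_le {f : Ω → ℝ} (hf : AEStronglyMeasurable f P) {K : ℝ}
    (h : ∀ᵐ x ∂P, |f x| ≤ K) : Integrable f P :=
  Integrable.of_bound hf K h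

lemma integral_mul_condExp (hm : m ≤ mΩ) {w f : Ω → ℝ} (hw : StronglyMeasurable[m] w) {K : ℝ}
    (hK : ∀ᵐ x ∂P, |w x| ≤ K) (hf : Integrable f P) :
    ∫ x, w x * (P[f|m]) x ∂P = ∫ x, w x * f x ∂P := by
  have h := condExp_stronglyMeasurable_mul_of_bound hm hw hf K hK
  calc ∫ x, w x * (P[f|m]) x ∂P = ∫ x, (P[w * f|m]) x ∂P :=
        (integral_congr_ae h).symm
    _ = ∫ x, (w * f) x ∂P := integral_condExp hm
    _ = _ := rfl

lemma ae_le_condExp {f : Ω → ℝ} (hm : m ≤ mΩ) (hf : Integrable f P) {a : ℝ}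
    (h : ∀ᵐ x ∂P, a ≤ f x) : ∀ᵐ x ∂P, a ≤ (P[f|m]) x := by
  have := condExp_mono (m := m) (integrable_const a) hf h
  rwa [condExp_const hm] at this

lemma ae_condExp_le {f : Ω → ℝ} (hm : m ≤ mΩ) (hf : Integrable f P) {a : ℝ}
    (h : ∀ᵐ x ∂P, f x ≤ a) : ∀ᵐ x ∂P, (P[f|m]) x ≤ a := by
  have := condExp_mono (m := m) hf (integrable_const a) h
  rwa [condExp_const hm] at this

lemma ae_nonneg_condExp_of_setIntegral_nonneg {f : Ω → ℝ} (hm : m ≤ mΩ) (hf : Integrable f P)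
    (h : ∀ A, MeasurableSet[m] A → P A ≠ 0 → 0 ≤ ∫ x in A, f x ∂P) :
    ∀ᵐ x ∂P, 0 ≤ (P[f|m]) x := by
  have hmeas : StronglyMeasurable[m] (P[f|m]) := stronglyMeasurable_condExp
  have h1 : 0 ≤ᵐ[P.trim hm] P[f|m] := by
    refine ae_nonneg_of_forall_setIntegral_nonneg
      (integrable_condExp.trim hm hmeas) fun A hA _ => ?_
    rw [← setIntegral_trim hm hmeas hA, setIntegral_condExp hm hf hA]
    by_cases h0 : P A = 0
    · rw [Measure.restrict_eq_zero.2 h0, integral_zero_measure]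
    · exact h A hA h0
  exact ae_of_ae_trim hm h1

/-- If averages of `θ` over two events of a σ-algebra `m` differ by little, in the sense of a
total variation bound weighted by the second moment, then the conditional expectation of `θ` is
close to a constant from above, relative to the conditional second moment. -/
lemma exists_const_sq_condExp_sub_le (hm : m ≤ mΩ) {θ : Ω → ℝ} (hθ : Measurable θ)
    (h01 : ∀ x, θ x ∈ Icc (0 : ℝ) 1) {δ : ℝ} (hδ : 0 ≤ δ)
    (h : ∀ A A', MeasurableSet[m] A → MeasurableSet[m] A' → P A ≠ 0 → P A' ≠ 0 →
      ∀ s : ℝ, 0 < s → (∫ x, θ x ∂P[|A]) - ∫ x, θ x ∂P[|A'] ≤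
        δ * s / 2 + (∫ x, θ x ^ 2 ∂P[|A]) / (2 * s)) :
    ∃ c : ℝ, |c| ≤ 1 ∧ ∀ᵐ x ∂P, c ≤ (P[θ|m]) x ∧
      ((P[θ|m]) x - c) ^ 2 ≤ δ * (P[fun x => θ x ^ 2|m]) x := by
  have hcond : ∀ (A : Set Ω) (f : Ω → ℝ), ∫ x, f x ∂P[|A] = (P.real A)⁻¹ * ∫ x in A, f x ∂P := by
    intro A f
    rw [ProbabilityTheory.cond, integral_smul_measure, smul_eq_mul, ENNReal.toReal_inv]; rfl
  have hθi : Integrable θ P := integrable_of_abs_le hθ.aestronglyMeasurable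
    (ae_of_all _ fun x => abs_le.2 ⟨by linarith [(h01 x).1], (h01 x).2⟩)
  have hθ2i : Integrable (fun x => θ x ^ 2) P := integrable_of_abs_le
    (hθ.pow_const 2).aestronglyMeasurable (K := 1)
    (ae_of_all _ fun x => abs_le.2 ⟨by nlinarith [(h01 x).1], by nlinarith [(h01 x).1, (h01 x).2]⟩)
  have havg : ∀ A, P A ≠ 0 → ∫ x, θ x ∂P[|A] ∈ Icc (0 : ℝ) 1 := by
    intro A hA
    have := cond_isProbabilityMeasure hA
    refine ⟨integral_nonneg fun x => (h01 x).1, ?_⟩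
    calc ∫ x, θ x ∂P[|A] ≤ ∫ x, (1 : ℝ) ∂P[|A] :=
          integral_mono_of_nonneg (ae_of_all _ fun x => (h01 x).1) (integrable_const _)
            (ae_of_all _ fun x => (h01 x).2)
      _ = 1 := by simp
  -- the constant is the least average of `θ` over events of `m`
  set V : Set ℝ := {v | ∃ A, MeasurableSet[m] A ∧ P A ≠ 0 ∧ v = ∫ x, θ x ∂P[|A]} with hV
  have hVne : V.Nonempty := ⟨_, univ, MeasurableSet.univ, by simp, rfl⟩
  have hVb : BddBelow V := ⟨0, by rintro v ⟨A, -, hA, rfl⟩; exact (havg A hA).1⟩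
  set c := sInf V with hc
  have hc0 : 0 ≤ c := le_csInf hVne (by rintro v ⟨A, -, hA, rfl⟩; exact (havg A hA).1)
  have hc1 : c ≤ 1 := by
    obtain ⟨v, A, hAm, hA, rfl⟩ := hVne
    exact (csInf_le hVb ⟨A, hAm, hA, rfl⟩).trans (havg A hA).2
  have hreal : ∀ A, P A ≠ 0 → 0 < P.real A := fun A hA =>
    ENNReal.toReal_pos hA (measure_ne_top _ _)
  have hlow : ∀ᵐ x ∂P, c ≤ (P[θ|m]) x := by
    have h1 : ∀ᵐ x ∂P, 0 ≤ (P[fun x => θ x - c|m]) x := by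
      refine ae_nonneg_condExp_of_setIntegral_nonneg hm (hθi.sub (integrable_const c)) ?_
      intro A hA hA0
      have h2 : c ≤ ∫ x, θ x ∂P[|A] := csInf_le hVb ⟨A, hA, hA0, rfl⟩
      rw [hcond, le_inv_mul_iff₀ (hreal A hA0)] at h2
      rw [integral_sub hθi.integrableOn (integrable_const c), setIntegral_const, smul_eq_mul]
      linarith
    have h3 : P[fun x => θ x - c|m] =ᵐ[P] P[θ|m] - P[fun _ => c|m] :=
      condExp_sub hθi (integrable_const c) m
    filter_upwards [h1, h3] with x hx h3x
    rw [h3x, Pi.sub_apply, condExp_const hm] at hx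
    linarith
  have hup : ∀ q : ℚ, 0 < q → ∀ᵐ x ∂P,
      (P[θ|m]) x - c ≤ δ * (q : ℝ) / 2 + (P[fun x => θ x ^ 2|m]) x / (2 * q) := by
    intro q hq
    have hq' : (0 : ℝ) < q := by exact_mod_cast hq
    have hi1 : Integrable (fun x => (1 / (2 * (q : ℝ))) • θ x ^ 2) P := hθ2i.const_mul _
    have hi2 : Integrable (fun _ : Ω => δ * (q : ℝ) / 2 + c) P := integrable_const _
    have h1 : ∀ᵐ x ∂P, 0 ≤
        (P[(fun x => (1 / (2 * (q : ℝ))) • θ x ^ 2) + (fun _ => δ * (q : ℝ) / 2 + c) - θ|m]) x := by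
      refine ae_nonneg_condExp_of_setIntegral_nonneg hm ((hi1.add hi2).sub hθi) ?_
      intro A hA hA0
      have h2 : (∫ x, θ x ∂P[|A]) - (δ * q / 2 + (∫ x, θ x ^ 2 ∂P[|A]) / (2 * q)) ≤ c := by
        refine le_csInf hVne ?_
        rintro v ⟨A', hA', hA'0, rfl⟩
        linarith [h A A' hA hA' hA0 hA'0 q hq']
      rw [hcond, hcond] at h2
      have h4 := mul_le_mul_of_nonneg_left h2 (hreal A hA0).le
      have h5 : P.real A * ((P.real A)⁻¹ * (∫ x in A, θ x ∂P) -
          (δ * q / 2 + ((P.real A)⁻¹ * ∫ x in A, θ x ^ 2 ∂P) / (2 * q))) =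
          (∫ x in A, θ x ∂P) - (P.real A * (δ * q / 2) +
            1 / (2 * q) * ∫ x in A, θ x ^ 2 ∂P) := by
        have := (hreal A hA0).ne'
        field_simp
      rw [h5] at h4
      change 0 ≤ ∫ x in A, ((1 / (2 * (q : ℝ))) • θ x ^ 2 + (δ * (q : ℝ) / 2 + c) - θ x) ∂P
      have hadd : Integrable (fun x => (1 / (2 * (q : ℝ))) • θ x ^ 2 + (δ * (q : ℝ) / 2 + c)) P :=
        hi1.add hi2
      rw [integral_sub hadd.integrableOn hθi.integrableOn,
        integral_add hi1.integrableOn hi2.integrableOn, setIntegral_const, smul_eq_mul,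
        integral_smul, smul_eq_mul]
      linarith
    have h3 := condExp_sub (hi1.add hi2) hθi m
    have h4 := condExp_add hi1 hi2 m
    have h5 := condExp_smul (μ := P) (1 / (2 * (q : ℝ))) (fun x => θ x ^ 2) m
    filter_upwards [h1, h3, h4, h5] with x hx h3x h4x h5x
    rw [h3x, Pi.sub_apply, h4x, Pi.add_apply, condExp_const hm] at hx
    have h6 : (P[fun x => (1 / (2 * (q : ℝ))) • θ x ^ 2|m]) x =
        (1 / (2 * (q : ℝ))) * (P[fun x => θ x ^ 2|m]) x := h5x
    rw [h6] at hx
    have h7 : (P[fun x => θ x ^ 2|m]) x / (2 * q) =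
      1 / (2 * q) * (P[fun x => θ x ^ 2|m]) x := by ring
    rw [h7]
    linarith
  have hup' : ∀ᵐ x ∂P, ∀ q : ℚ, 0 < q →
      (P[θ|m]) x - c ≤ δ * (q : ℝ) / 2 + (P[fun x => θ x ^ 2|m]) x / (2 * q) := by
    rw [ae_all_iff]
    intro q
    by_cases hq : 0 < q
    · filter_upwards [hup q hq] with x hx _ using hx
    · exact ae_of_all _ fun x h => absurd h hq
  refine ⟨c, abs_le.2 ⟨by linarith, hc1⟩, ?_⟩
  filter_upwards [hlow, hup', ae_le_condExp hm hθ2i (ae_of_all _ fun x => sq_nonneg (θ x))]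
    with x h1 h2 h3
  exact ⟨h1, sq_le_mul_of_forall_le (by linarith) hδ h3 h2⟩

/-- Comparison of the means of a nonnegative function under two measures: by Hahn decomposition
and `t ≤ s / 2 + t² / (2 s)`, only the excess mass of `ν` over `ν'` contributes. -/
lemma integral_sub_integral_le_of_measure_sub_le {S : Type*} [MeasurableSpace S]
    {ν ν' : Measure S} [IsProbabilityMeasure ν] [IsProbabilityMeasure ν'] {δ : ℝ}
    (h : ∀ B, MeasurableSet B → ν.real B - ν'.real B ≤ δ) {t : S → ℝ} (ht : Measurable t)
    (h01 : ∀ x, t x ∈ Icc (0 : ℝ) 1) {s : ℝ} (hs : 0 < s) :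
    (∫ x, t x ∂ν) - ∫ x, t x ∂ν' ≤ δ * s / 2 + (∫ x, t x ^ 2 ∂ν) / (2 * s) := by
  have hti : ∀ (ξ : Measure S) [IsFiniteMeasure ξ], Integrable t ξ := fun ξ _ =>
    Integrable.of_bound ht.aestronglyMeasurable 1
      (ae_of_all _ fun x => abs_le.2 ⟨by linarith [(h01 x).1], (h01 x).2⟩)
  have ht2i : ∀ (ξ : Measure S) [IsFiniteMeasure ξ], Integrable (fun x => t x ^ 2) ξ := fun ξ _ =>
    Integrable.of_bound (ht.pow_const 2).aestronglyMeasurable 1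
      (ae_of_all _ fun x => abs_le.2 ⟨by nlinarith [(h01 x).1],
        by nlinarith [(h01 x).1, (h01 x).2]⟩)
  obtain ⟨B, hB⟩ := exists_isHahnDecomposition ν' ν
  have hBm := hB.measurableSet
  have h1 : ∫ x in Bᶜ, t x ∂ν ≤ ∫ x in Bᶜ, t x ∂ν' :=
    integral_mono_measure hB.ge_on_compl (ae_of_all _ fun x => (h01 x).1) (hti _)
  -- the gap `s / 2 + t² / (2 s) - t` is a nonnegative multiple of `(t - s)²`
  have h2 : ∫ x in B, (s / 2 + t x ^ 2 / (2 * s) - t x) ∂ν' ≤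
      ∫ x in B, (s / 2 + t x ^ 2 / (2 * s) - t x) ∂ν := by
    refine integral_mono_measure hB.le_on (ae_of_all _ fun x => ?_)
      (((integrable_const _).add ((ht2i _).div_const _)).sub (hti _))
    have : s / 2 + t x ^ 2 / (2 * s) - t x = (t x - s) ^ 2 / (2 * s) := by
      field_simp; ring
    change 0 ≤ s / 2 + t x ^ 2 / (2 * s) - t x
    rw [this]
    positivity
  have h3 : ∀ (ξ : Measure S) [IsFiniteMeasure ξ],
      ∫ x in B, (s / 2 + t x ^ 2 / (2 * s) - t x) ∂ξ =
      ξ.real B * (s / 2) + (∫ x in B, t x ^ 2 ∂ξ) / (2 * s) - ∫ x in B, t x ∂ξ := by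
    intro ξ _
    have hadd : Integrable (fun x => s / 2 + t x ^ 2 / (2 * s)) (ξ.restrict B) :=
      (integrable_const _).add ((ht2i _).div_const _)
    rw [integral_sub hadd (hti _), integral_add (integrable_const _) ((ht2i _).div_const _),
      setIntegral_const, smul_eq_mul, integral_div]
  rw [h3, h3] at h2
  have h4 : 0 ≤ (∫ x in B, t x ^ 2 ∂ν') / (2 * s) := by
    have : 0 ≤ ∫ x in B, t x ^ 2 ∂ν' := integral_nonneg fun x => sq_nonneg _
    positivity
  have h5 : (∫ x in B, t x ^ 2 ∂ν) / (2 * s) ≤ (∫ x, t x ^ 2 ∂ν) / (2 * s) := by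
    exact div_le_div_of_nonneg_right
      (setIntegral_le_integral (ht2i ν) (ae_of_all _ fun x => sq_nonneg (t x))) (by positivity)
  have h6 := mul_le_mul_of_nonneg_right (h B hBm) (by positivity : 0 ≤ s / 2)
  rw [← integral_add_compl hBm (hti ν), ← integral_add_compl hBm (hti ν')]
  linarith

end CondExp

/-! ### Martingale increments of a density -/

section Martingale

variable {Ω : Type*} {𝒢 𝒢' 𝒥 : MeasurableSpace Ω} [mΩ : MeasurableSpace Ω] {P : Measure Ω}
  [IsProbabilityMeasure P]

/-- Revealing the information in `𝒢'` on top of `𝒢` moves the conditional law of the `𝒥`-measurable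
variables by at most `δ`. It is encoded by one-sided second-moment bounds: the conditional
expectation of a `𝒥`-measurable `θ ∈ [0, 1]` exceeds some `𝒢`-measurable lower bound `c` by at most
the square root of `δ` times its conditional second moment. -/
def MixingBound (P : Measure Ω) (𝒢 𝒢' 𝒥 : MeasurableSpace Ω) (δ : ℝ) : Prop :=
  ∀ θ : Ω → ℝ, Measurable[𝒥] θ → (∀ x, θ x ∈ Icc (0 : ℝ) 1) →
    ∃ c : Ω → ℝ, StronglyMeasurable[𝒢] c ∧ (∀ᵐ x ∂P, |c x| ≤ 1) ∧
      ∀ᵐ x ∂P, c x ≤ (P[θ|𝒢']) x ∧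
        ((P[θ|𝒢']) x - c x) ^ 2 ≤ δ * (P[fun x => θ x ^ 2|𝒢']) x

/-- The `χ²`-type energy `𝔼 [(a - b)₊² / a]` of the increment from `a = 𝔼[ρ | 𝒢]` to
`b = 𝔼[ρ | 𝒢']`. -/
noncomputable def incrementEnergy (P : Measure Ω) (ρ : Ω → ℝ) (𝒢 𝒢' : MeasurableSpace Ω) : ℝ :=
  ∫ x, (max ((P[ρ|𝒢]) x - (P[ρ|𝒢']) x) 0) ^ 2 / (P[ρ|𝒢]) x ∂P

variable {ρ : Ω → ℝ} {ε M : ℝ}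

lemma integrable_of_mem_Icc (hρ : Measurable ρ) (hb : ∀ x, ρ x ∈ Icc ε M) : Integrable ρ P :=
  Integrable.of_mem_Icc ε M hρ.aemeasurable (ae_of_all _ hb)

lemma ae_condExp_mem_Icc (hρ : Measurable ρ) (hb : ∀ x, ρ x ∈ Icc ε M)
    (h𝒢 : 𝒢 ≤ mΩ) : ∀ᵐ x ∂P, (P[ρ|𝒢]) x ∈ Icc ε M := by
  have hi := integrable_of_mem_Icc (P := P) hρ hb
  filter_upwards [ae_le_condExp h𝒢 hi (ae_of_all _ fun x => (hb x).1),
    ae_condExp_le h𝒢 hi (ae_of_all _ fun x => (hb x).2)] with x h1 h2 using ⟨h1, h2⟩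

lemma integrable_incrementEnergy (hρ : Measurable ρ) (hε : 0 < ε) (hb : ∀ x, ρ x ∈ Icc ε M)
    (h𝒢 : 𝒢 ≤ mΩ) (h𝒢' : 𝒢' ≤ mΩ) :
    Integrable (fun x => (max ((P[ρ|𝒢]) x - (P[ρ|𝒢']) x) 0) ^ 2 / (P[ρ|𝒢]) x) P := by
  have ma : Measurable (P[ρ|𝒢]) := (stronglyMeasurable_condExp.mono h𝒢).measurable
  have mb : Measurable (P[ρ|𝒢']) := (stronglyMeasurable_condExp.mono h𝒢').measurable
  refine integrable_of_abs_le (K := M ^ 2 / ε)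
    (Measurable.aestronglyMeasurable
      ((((ma.sub mb).max measurable_const).pow_const 2).div ma)) ?_
  filter_upwards [ae_condExp_mem_Icc hρ hb h𝒢, ae_condExp_mem_Icc hρ hb h𝒢'] with x ha hb'
  have h1 : 0 ≤ max ((P[ρ|𝒢]) x - (P[ρ|𝒢']) x) 0 := le_max_right _ _
  have h2 : max ((P[ρ|𝒢]) x - (P[ρ|𝒢']) x) 0 ≤ M :=
    max_le (by linarith [ha.2, hb'.1]) (by linarith [ha.1, ha.2])
  have h3 : 0 < (P[ρ|𝒢]) x := hε.trans_le ha.1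
  rw [abs_of_nonneg (by positivity)]
  exact div_le_div₀ (by positivity) (pow_le_pow_left₀ h1 h2 2) hε ha.1

lemma incrementEnergy_nonneg (hρ : Measurable ρ) (hε : 0 < ε) (hb : ∀ x, ρ x ∈ Icc ε M)
    (h𝒢 : 𝒢 ≤ mΩ) : 0 ≤ incrementEnergy P ρ 𝒢 𝒢' := by
  refine integral_nonneg_of_ae ?_
  filter_upwards [ae_condExp_mem_Icc hρ hb h𝒢] with x ha
  have h3 : 0 < (P[ρ|𝒢]) x := hε.trans_le ha.1
  exact div_nonneg (sq_nonneg _) h3.le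

/-- The energies of the increments of the density martingale are dominated by the relative entropy,
by the chain rule. -/
lemma sum_incrementEnergy_le (hρ : Measurable ρ) (hε : 0 < ε) (hb : ∀ x, ρ x ∈ Icc ε M)
    (hρ1 : ∫ x, ρ x ∂P = 1) {𝓕 : ℕ → MeasurableSpace Ω} (hmono : Monotone 𝓕) (hle : ∀ n, 𝓕 n ≤ mΩ)
    (h0 : 𝓕 0 = ⊥) {T : ℕ} (hT : Measurable[𝓕 T] ρ) :
    ∑ n ∈ Finset.range T, incrementEnergy P ρ (𝓕 n) (𝓕 (n + 1)) ≤
      2 * ∫ x, ρ x * Real.log (ρ x) ∂P := by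
  have hρi := integrable_of_mem_Icc (P := P) hρ hb
  obtain ⟨L, hL⟩ : ∃ L : ℝ, ∀ u ∈ Icc ε M, |Real.log u| ≤ L := by
    refine ⟨max |Real.log ε| |Real.log M|, fun u hu => ?_⟩
    exact abs_le_max_abs_abs (Real.log_le_log hε hu.1) (Real.log_le_log (hε.trans_le hu.1) hu.2)
  have hmb : ∀ n, ∀ᵐ x ∂P, (P[ρ|𝓕 n]) x ∈ Icc ε M := fun n => ae_condExp_mem_Icc hρ hb (hle n)
  have hms : ∀ n, Measurable (P[ρ|𝓕 n]) := fun n => (stronglyMeasurable_condExp.mono (hle n)).measurable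
  have hlogi : ∀ n k, Integrable (fun x => (P[ρ|𝓕 n]) x * Real.log ((P[ρ|𝓕 k]) x)) P := by
    intro n k
    have := hms n
    have := hms k
    refine integrable_of_abs_le (K := M * L) (by fun_prop) ?_
    filter_upwards [hmb n, hmb k] with x h1 h2
    rw [abs_mul, abs_of_nonneg (hε.le.trans h1.1)]
    exact mul_le_mul h1.2 (hL _ h2) (abs_nonneg _) (hε.le.trans (h1.1.trans h1.2))
  have hcross : ∀ n, ∫ x, (P[ρ|𝓕 (n + 1)]) x * Real.log ((P[ρ|𝓕 n]) x) ∂P =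
      ∫ x, (P[ρ|𝓕 n]) x * Real.log ((P[ρ|𝓕 n]) x) ∂P := by
    intro n
    have hlm : StronglyMeasurable[𝓕 n] (fun x => Real.log ((P[ρ|𝓕 n]) x)) := by
      have h1 : Measurable[𝓕 n] (P[ρ|𝓕 n]) := stronglyMeasurable_condExp.measurable
      exact (Real.measurable_log.comp h1).stronglyMeasurable
    have hlb : ∀ᵐ x ∂P, |Real.log ((P[ρ|𝓕 n]) x)| ≤ L := by
      filter_upwards [hmb n] with x hx using hL _ hx
    have e1 := integral_mul_condExp (hle n) hlm hlb hρi
    have e2 := integral_mul_condExp (hle (n + 1)) (hlm.mono (hmono n.le_succ)) hlb hρi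
    simp_rw [mul_comm _ (Real.log _)]
    rw [e1, e2]
  have hstep : ∀ n, incrementEnergy P ρ (𝓕 n) (𝓕 (n + 1)) ≤
      2 * (∫ x, (P[ρ|𝓕 (n + 1)]) x * Real.log ((P[ρ|𝓕 (n + 1)]) x) ∂P) -
      2 * ∫ x, (P[ρ|𝓕 n]) x * Real.log ((P[ρ|𝓕 n]) x) ∂P := by
    intro n
    have i1 := hlogi (n + 1) (n + 1)
    have i2 := hlogi (n + 1) n
    have i3 : Integrable (P[ρ|𝓕 (n + 1)]) P := integrable_condExp
    have i4 : Integrable (P[ρ|𝓕 n]) P := integrable_condExp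
    have i12 : Integrable (fun x => (P[ρ|𝓕 (n + 1)]) x * Real.log ((P[ρ|𝓕 (n + 1)]) x) -
        (P[ρ|𝓕 (n + 1)]) x * Real.log ((P[ρ|𝓕 n]) x)) P := i1.sub i2
    have i123 : Integrable (fun x => (P[ρ|𝓕 (n + 1)]) x * Real.log ((P[ρ|𝓕 (n + 1)]) x) -
        (P[ρ|𝓕 (n + 1)]) x * Real.log ((P[ρ|𝓕 n]) x) - (P[ρ|𝓕 (n + 1)]) x) P := i12.sub i3
    calc incrementEnergy P ρ (𝓕 n) (𝓕 (n + 1))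
        ≤ ∫ x, 2 * ((P[ρ|𝓕 (n + 1)]) x * Real.log ((P[ρ|𝓕 (n + 1)]) x) -
            (P[ρ|𝓕 (n + 1)]) x * Real.log ((P[ρ|𝓕 n]) x) - (P[ρ|𝓕 (n + 1)]) x +
            (P[ρ|𝓕 n]) x) ∂P := by
          refine integral_mono_ae (integrable_incrementEnergy hρ hε hb (hle _) (hle _))
            ((i123.add i4).const_mul 2) ?_
          filter_upwards [hmb n, hmb (n + 1)] with x h1 h2
          exact sq_posPart_sub_div_le (hε.trans_le h1.1) (hε.trans_le h2.1)
      _ = _ := by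
          rw [integral_const_mul, integral_add i123 i4, integral_sub i12 i3,
            integral_sub i1 i2, hcross n, integral_condExp (hle _), integral_condExp (hle _)]
          ring
  calc ∑ n ∈ Finset.range T, incrementEnergy P ρ (𝓕 n) (𝓕 (n + 1))
      ≤ ∑ n ∈ Finset.range T,
        (2 * (∫ x, (P[ρ|𝓕 (n + 1)]) x * Real.log ((P[ρ|𝓕 (n + 1)]) x) ∂P) -
          2 * ∫ x, (P[ρ|𝓕 n]) x * Real.log ((P[ρ|𝓕 n]) x) ∂P) :=
        Finset.sum_le_sum fun n _ => hstep n
    _ = _ := by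
        rw [Finset.sum_range_sub
          (fun n => 2 * ∫ x, (P[ρ|𝓕 n]) x * Real.log ((P[ρ|𝓕 n]) x) ∂P),
          condExp_of_stronglyMeasurable (hle T) hT.stronglyMeasurable hρi, h0, condExp_bot, hρ1]
        simp

/-- New information determining the `𝒥`-measurable variables moves them by at most `1`. -/
lemma mixingBound_one (h𝒢' : 𝒢' ≤ mΩ)
    (h : 𝒥 ≤ 𝒢') : MixingBound P 𝒢 𝒢' 𝒥 1 := by
  intro θ hθ h01
  have hm : Measurable[𝒢'] θ := hθ.mono h le_rfl
  have hi : Integrable θ P := integrable_of_mem_Icc (hm.mono h𝒢' le_rfl) h01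
  have hi2 : Integrable (fun x => θ x ^ 2) P :=
    integrable_of_mem_Icc ((hm.mono h𝒢' le_rfl).pow_const 2)
      fun x => ⟨sq_nonneg _, pow_le_one₀ (h01 x).1 (h01 x).2⟩
  refine ⟨fun _ => 0, stronglyMeasurable_const, ae_of_all _ fun _ => by simp, ae_of_all _ ?_⟩
  intro x
  rw [condExp_of_stronglyMeasurable h𝒢' hm.stronglyMeasurable hi,
    condExp_of_stronglyMeasurable h𝒢' (hm.pow_const 2).stronglyMeasurable hi2]
  exact ⟨(h01 x).1, by simp⟩

/-- Variables that are already known are not moved. -/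
lemma mixingBound_zero (h𝒢' : 𝒢' ≤ mΩ)
    (h𝒢𝒢' : 𝒢 ≤ 𝒢') (h : 𝒥 ≤ 𝒢) : MixingBound P 𝒢 𝒢' 𝒥 0 := by
  intro θ hθ h01
  have hm : Measurable[𝒢] θ := hθ.mono h le_rfl
  have hi : Integrable θ P := integrable_of_mem_Icc (hm.mono (h𝒢𝒢'.trans h𝒢') le_rfl) h01
  refine ⟨θ, hm.stronglyMeasurable, ae_of_all _ fun x => ?_, ae_of_all _ fun x => ?_⟩
  · rw [abs_of_nonneg (h01 x).1]; exact (h01 x).2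
  · rw [condExp_of_stronglyMeasurable h𝒢' (hm.stronglyMeasurable.mono h𝒢𝒢') hi]
    simp

/-- The increments of the density contract under conditioning: the energy seen through a
`𝒥`-measurable `θ` is at most `δ` times the full energy. Both factors of the Cauchy–Schwarz
inequality for `𝔼 [(a - b) (𝔼[θ | 𝒢'] - c)]` reappear, one of them as the left-hand side. -/
lemma integral_mul_sq_le_of_mixingBound (hρ : Measurable ρ) (hε : 0 < ε)
    (hb : ∀ x, ρ x ∈ Icc ε M) (h𝒢𝒢' : 𝒢 ≤ 𝒢')
    (h𝒢' : 𝒢' ≤ mΩ) (h𝒥 : 𝒥 ≤ mΩ) {δ : ℝ} (hδ : 0 ≤ δ) (hmix : MixingBound P 𝒢 𝒢' 𝒥 δ)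
    {θ : Ω → ℝ} (hθ : Measurable[𝒥] θ) (h01 : ∀ x, θ x ∈ Icc (0 : ℝ) 1)
    (hK : ∫ x, (P[ρ|𝒢]) x * θ x ^ 2 ∂P = ∫ x, ((P[ρ|𝒢]) x - (P[ρ|𝒢']) x) * θ x ∂P) :
    ∫ x, (P[ρ|𝒢]) x * θ x ^ 2 ∂P ≤ δ * incrementEnergy P ρ 𝒢 𝒢' := by
  obtain ⟨c, hcm, hc1, hc⟩ := hmix θ hθ h01
  have h𝒢 := h𝒢𝒢'.trans h𝒢'
  have hρi := integrable_of_mem_Icc (P := P) hρ hb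
  have hθm : Measurable θ := hθ.mono h𝒥 le_rfl
  have hab := ae_condExp_mem_Icc (P := P) hρ hb h𝒢
  have hbb := ae_condExp_mem_Icc (P := P) hρ hb h𝒢'
  have ma : Measurable (P[ρ|𝒢]) := (stronglyMeasurable_condExp.mono h𝒢).measurable
  have mb : Measurable (P[ρ|𝒢']) := (stronglyMeasurable_condExp.mono h𝒢').measurable
  have h201 : ∀ x, θ x ^ 2 ∈ Icc (0 : ℝ) 1 := fun x =>
    ⟨sq_nonneg _, pow_le_one₀ (h01 x).1 (h01 x).2⟩
  have hθi : Integrable θ P := integrable_of_mem_Icc hθm h01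
  have hθ2i : Integrable (fun x => θ x ^ 2) P := integrable_of_mem_Icc (hθm.pow_const 2) h201
  have hΘ := ae_condExp_mem_Icc (P := P) hθm h01 h𝒢'
  have hΨ := ae_condExp_mem_Icc (P := P) (hθm.pow_const 2) h201 h𝒢'
  have mΘ : Measurable (P[θ|𝒢']) := (stronglyMeasurable_condExp.mono h𝒢').measurable
  have mΨ : Measurable (P[fun x => θ x ^ 2|𝒢']) := (stronglyMeasurable_condExp.mono h𝒢').measurable
  have mc : Measurable c := (hcm.mono h𝒢).measurable
  have sa : StronglyMeasurable[𝒢'] (P[ρ|𝒢]) := stronglyMeasurable_condExp.mono h𝒢𝒢'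
  have sb : StronglyMeasurable[𝒢'] (P[ρ|𝒢']) := stronglyMeasurable_condExp
  have babs : ∀ᵐ x ∂P, |(P[ρ|𝒢]) x| ≤ M := by
    filter_upwards [hab] with x hx
    rw [abs_of_nonneg (hε.le.trans hx.1)]; exact hx.2
  have dabs : ∀ᵐ x ∂P, |(P[ρ|𝒢]) x - (P[ρ|𝒢']) x| ≤ M := by
    filter_upwards [hab, hbb] with x hx hy
    exact abs_le.2 ⟨by linarith [hx.1, hy.2], by linarith [hx.2, hy.1]⟩
  have hM : 0 ≤ M := by
    obtain ⟨x, hx⟩ := hab.exists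
    exact hε.le.trans (hx.1.trans hx.2)
  -- replace `θ` by its conditional expectation
  have e1 : ∫ x, ((P[ρ|𝒢]) x - (P[ρ|𝒢']) x) * (P[θ|𝒢']) x ∂P =
      ∫ x, ((P[ρ|𝒢]) x - (P[ρ|𝒢']) x) * θ x ∂P :=
    integral_mul_condExp h𝒢' (sa.sub sb) dabs hθi
  have e2 : ∫ x, (P[ρ|𝒢]) x * (P[fun x => θ x ^ 2|𝒢']) x ∂P = ∫ x, (P[ρ|𝒢]) x * θ x ^ 2 ∂P :=
    integral_mul_condExp h𝒢' sa babs hθ2i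
  -- the increment is orthogonal to `c`
  have ica : Integrable (fun x => c x * (P[ρ|𝒢]) x) P := by
    refine integrable_of_abs_le (K := 1 * M) (by fun_prop) ?_
    filter_upwards [hc1, babs] with x h1 h2
    rw [abs_mul]; exact mul_le_mul h1 h2 (abs_nonneg _) zero_le_one
  have icb : Integrable (fun x => c x * (P[ρ|𝒢']) x) P := by
    refine integrable_of_abs_le (K := 1 * M) (by fun_prop) ?_
    filter_upwards [hc1, hbb] with x h1 h2
    rw [abs_mul, abs_of_nonneg (hε.le.trans h2.1)]
    exact mul_le_mul h1 h2.2 (hε.le.trans h2.1) zero_le_one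
  have e3 : ∫ x, ((P[ρ|𝒢]) x - (P[ρ|𝒢']) x) * c x ∂P = 0 := by
    have e4 := integral_mul_condExp h𝒢 hcm hc1 hρi
    have e5 := integral_mul_condExp h𝒢' (hcm.mono h𝒢𝒢') hc1 hρi
    calc ∫ x, ((P[ρ|𝒢]) x - (P[ρ|𝒢']) x) * c x ∂P
        = ∫ x, (c x * (P[ρ|𝒢]) x - c x * (P[ρ|𝒢']) x) ∂P := by congr 1; ext x; ring
      _ = 0 := by rw [integral_sub ica icb, e4, e5, sub_self]
  have iΘ : Integrable (fun x => ((P[ρ|𝒢]) x - (P[ρ|𝒢']) x) * (P[θ|𝒢']) x) P := by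
    refine integrable_of_abs_le (K := M * 1) (by fun_prop) ?_
    filter_upwards [dabs, hΘ] with x h1 h2
    rw [abs_mul, abs_of_nonneg h2.1]
    exact mul_le_mul h1 h2.2 h2.1 hM
  have ic : Integrable (fun x => ((P[ρ|𝒢]) x - (P[ρ|𝒢']) x) * c x) P := by
    refine integrable_of_abs_le (K := M * 1) (by fun_prop) ?_
    filter_upwards [dabs, hc1] with x h1 h2
    rw [abs_mul]
    exact mul_le_mul h1 h2 (abs_nonneg _) hM
  have iΨ : Integrable (fun x => (P[ρ|𝒢]) x * (P[fun x => θ x ^ 2|𝒢']) x) P := by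
    refine integrable_of_abs_le (K := M * 1) (by fun_prop) ?_
    filter_upwards [babs, hΨ] with x h1 h2
    rw [abs_mul, abs_of_nonneg h2.1]
    exact mul_le_mul h1 h2.2 h2.1 hM
  have iB := integrable_incrementEnergy (P := P) hρ hε hb h𝒢 h𝒢'
  have key : ∫ x, (((P[ρ|𝒢]) x - (P[ρ|𝒢']) x) * (P[θ|𝒢']) x -
        ((P[ρ|𝒢]) x - (P[ρ|𝒢']) x) * c x) ∂P ≤
      ∫ x, (δ / 2 * ((max ((P[ρ|𝒢]) x - (P[ρ|𝒢']) x) 0) ^ 2 / (P[ρ|𝒢]) x) +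
        1 / 2 * ((P[ρ|𝒢]) x * (P[fun x => θ x ^ 2|𝒢']) x)) ∂P := by
    refine integral_mono_ae (iΘ.sub ic) ((iB.const_mul _).add (iΨ.const_mul _)) ?_
    filter_upwards [hab, hc, hΨ] with x ha hcx hψ
    have ha0 : 0 < (P[ρ|𝒢]) x := hε.trans_le ha.1
    generalize (P[ρ|𝒢]) x = a at *
    generalize (P[ρ|𝒢']) x = b at *
    generalize (P[θ|𝒢']) x = t at *
    generalize (P[fun x => θ x ^ 2|𝒢']) x = p at *
    obtain ⟨h1, h2⟩ := hcx
    have hd0 : 0 ≤ max (a - b) 0 := le_max_right _ _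
    have h3 : (a - b) * t - (a - b) * c x ≤ max (a - b) 0 * (t - c x) := by
      rw [← mul_sub]
      exact mul_le_mul_of_nonneg_right (le_max_left _ _) (by linarith)
    refine h3.trans ?_
    generalize max (a - b) 0 = d at *
    have hu : 0 ≤ t - c x := by linarith
    generalize t - c x = u at *
    have h4 : (d * u) ^ 2 ≤ (δ / 2 * (d ^ 2 / a) + 1 / 2 * (a * p)) ^ 2 := by
      have h5 : (d * u) ^ 2 ≤ (δ * (d ^ 2 / a)) * (a * p) := by
        have : (δ * (d ^ 2 / a)) * (a * p) = d ^ 2 * (δ * p) := by field_simp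
        rw [this, mul_pow]
        exact mul_le_mul_of_nonneg_left h2 (sq_nonneg _)
      nlinarith [sq_nonneg (δ * (d ^ 2 / a) - a * p)]
    have h6 : 0 ≤ δ / 2 * (d ^ 2 / a) + 1 / 2 * (a * p) := by
      have := hψ.1
      positivity
    exact le_of_abs_le (abs_le_of_sq_le_sq h4 h6)
  rw [integral_sub iΘ ic, e3, integral_add (iB.const_mul _) (iΨ.const_mul _), integral_const_mul,
    integral_const_mul, e1, ← hK, e2] at key
  rw [incrementEnergy]
  linarith

lemma integral_mul_le_sqrt_mul_sqrt {f g : Ω → ℝ} (hf : Measurable f) (hg : Measurable g)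
    {K L : ℝ} (hf0 : ∀ x, f x ∈ Icc 0 K) (hg0 : ∀ᵐ x ∂P, g x ∈ Icc 0 L) :
    ∫ x, f x * g x ∂P ≤ √(∫ x, f x ^ 2 ∂P) * √(∫ x, g x ^ 2 ∂P) := by
  have h := integral_mul_le_Lp_mul_Lq_of_nonneg (μ := P) (f := f) (g := g)
    Real.HolderConjugate.two_two
    (ae_of_all _ fun x => (hf0 x).1) (hg0.mono fun x hx => hx.1)
    (MemLp.of_bound hf.aestronglyMeasurable K (ae_of_all _ fun x => by
      rw [Real.norm_eq_abs, abs_of_nonneg (hf0 x).1]; exact (hf0 x).2))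
    (MemLp.of_bound hg.aestronglyMeasurable L (hg0.mono fun x hx => by
      rw [Real.norm_eq_abs, abs_of_nonneg hx.1]; exact hx.2))
  simpa only [Real.rpow_two, ← Real.sqrt_eq_rpow] using h

/-- The change of mean of a `𝒥`-measurable `g ≥ 0` under a change of measure with density `ρ`,
estimated along the density martingale. Only the second moment of `g` under the original measure
enters: the part of the mass of `𝒥` that has not been moved yet is at most the original one. -/
lemma integral_mul_one_sub_le_sum (hρ : Measurable ρ) (hε : 0 < ε) (hb : ∀ x, ρ x ∈ Icc ε M)
    (hρ1 : ∫ x, ρ x ∂P = 1) {𝓕 : ℕ → MeasurableSpace Ω} (hmono : Monotone 𝓕) (hle : ∀ n, 𝓕 n ≤ mΩ)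
    (h0 : 𝓕 0 = ⊥) {T : ℕ} (hT : Measurable[𝓕 T] ρ) (h𝒥 : 𝒥 ≤ mΩ)
    {δ : ℕ → ℝ} (hδ : ∀ n, 0 ≤ δ n) (hmix : ∀ n < T, MixingBound P (𝓕 n) (𝓕 (n + 1)) 𝒥 (δ n))
    {g : Ω → ℝ} (hg : Measurable[𝒥] g) {N : ℝ} (hgN : ∀ x, g x ∈ Icc 0 N) :
    ∫ x, g x * (1 - ρ x) ∂P ≤ ∑ n ∈ Finset.range T,
      √(∫ x, g x ^ 2 ∂P) * (√(δ n) * √(incrementEnergy P ρ (𝓕 n) (𝓕 (n + 1)))) := by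
  have hρi := integrable_of_mem_Icc (P := P) hρ hb
  have hgm : Measurable g := hg.mono h𝒥 le_rfl
  have hgi : Integrable g P := integrable_of_mem_Icc hgm hgN
  set X : ℕ → Ω → ℝ := fun n => P[P[ρ|𝓕 n]|𝒥] with hX
  have hXm' : ∀ n, Measurable[𝒥] (X n) := fun n => stronglyMeasurable_condExp.measurable
  have hXm : ∀ n, Measurable (X n) := fun n => (hXm' n).mono h𝒥 le_rfl
  have hXb : ∀ n, ∀ᵐ x ∂P, X n x ∈ Icc ε M := by
    intro n
    have hi : Integrable (P[ρ|𝓕 n]) P := integrable_condExp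
    have h := ae_condExp_mem_Icc (P := P) hρ hb (hle n)
    filter_upwards [ae_le_condExp h𝒥 hi (h.mono fun x hx => hx.1),
      ae_condExp_le h𝒥 hi (h.mono fun x hx => hx.2)] with x h1 h2 using ⟨h1, h2⟩
  set θ : ℕ → Ω → ℝ := fun n x => max 0 (min 1 (1 - X (n + 1) x / X n x)) with hθ
  have hθm' : ∀ n, Measurable[𝒥] (θ n) := fun n =>
    measurable_const.max (measurable_const.min
      (measurable_const.sub ((hXm' (n + 1)).div (hXm' n))))
  have hθm : ∀ n, Measurable (θ n) := fun n => (hθm' n).mono h𝒥 le_rfl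
  have hθ01 : ∀ n x, θ n x ∈ Icc (0 : ℝ) 1 := fun n x =>
    ⟨le_max_left _ _, max_le zero_le_one (min_le_left _ _)⟩
  -- on positive values the truncation at `1` is immaterial
  have hθeq : ∀ n, ∀ᵐ x ∂P, θ n x = max 0 (1 - X (n + 1) x / X n x) := by
    intro n
    filter_upwards [hXb n, hXb (n + 1)] with x h1 h2
    have : 0 ≤ X (n + 1) x / X n x := div_nonneg (hε.le.trans h2.1) (hε.le.trans h1.1)
    simp only [hθ]
    rw [min_eq_right (by linarith)]
  have hX0 : ∀ᵐ x ∂P, X 0 x = 1 := by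
    refine ae_of_all _ fun x => ?_
    simp only [hX]
    rw [h0, condExp_bot, hρ1, condExp_const h𝒥]
  have hlast : ∫ x, g x * X T x ∂P = ∫ x, g x * ρ x ∂P := by
    simp only [hX]
    rw [condExp_of_stronglyMeasurable (hle T) hT.stronglyMeasurable hρi]
    exact integral_mul_condExp h𝒥 hg.stronglyMeasurable
      (ae_of_all _ fun x => by rw [abs_of_nonneg (hgN x).1]; exact (hgN x).2) hρi
  have hpt : ∀ᵐ x ∂P, 1 - X T x ≤ ∑ n ∈ Finset.range T, min 1 (X n x) * θ n x := by
    filter_upwards [ae_all_iff.2 hXb, ae_all_iff.2 hθeq, hX0] with x h1 h2 h3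
    have := one_sub_le_sum_min_mul (m := fun n => X n x) h3 (fun n => hε.trans_le (h1 n).1) T
    simpa only [h2] using this
  have hsb : ∀ n, ∀ᵐ x ∂P, min 1 (X n x) * θ n x ∈ Icc (0 : ℝ) 1 := by
    intro n
    filter_upwards [hXb n] with x h1
    have h2 : 0 ≤ min 1 (X n x) := le_min zero_le_one (hε.le.trans h1.1)
    exact ⟨mul_nonneg h2 (hθ01 n x).1, mul_le_one₀ (min_le_left _ _) (hθ01 n x).1 (hθ01 n x).2⟩
  have hsm : ∀ n, Measurable (fun x => min 1 (X n x) * θ n x) := fun n =>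
    (measurable_const.min (hXm n)).mul (hθm n)
  have hgs : ∀ n, Integrable (fun x => g x * (min 1 (X n x) * θ n x)) P := by
    intro n
    refine integrable_of_abs_le (K := N * 1) (hgm.mul (hsm n)).aestronglyMeasurable ?_
    filter_upwards [hsb n] with x h1
    rw [abs_mul, abs_of_nonneg (hgN x).1, abs_of_nonneg h1.1]
    exact mul_le_mul (hgN x).2 h1.2 h1.1 ((hgN x).1.trans (hgN x).2)
  have hgX : ∀ {f : Ω → ℝ}, Measurable f → (∀ᵐ x ∂P, f x ∈ Icc ε M) →
      Integrable (fun x => g x * f x) P := by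
    intro f hf hfb
    refine integrable_of_abs_le (K := N * M) (hgm.mul hf).aestronglyMeasurable ?_
    filter_upwards [hfb] with x h1
    rw [abs_mul, abs_of_nonneg (hgN x).1, abs_of_nonneg (hε.le.trans h1.1)]
    exact mul_le_mul (hgN x).2 h1.2 (hε.le.trans h1.1) ((hgN x).1.trans (hgN x).2)
  have hstep : ∀ n < T, ∫ x, g x * (min 1 (X n x) * θ n x) ∂P ≤
      √(∫ x, g x ^ 2 ∂P) * (√(δ n) * √(incrementEnergy P ρ (𝓕 n) (𝓕 (n + 1)))) := by
    intro n hn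
    refine (integral_mul_le_sqrt_mul_sqrt hgm (hsm n) hgN (hsb n)).trans ?_
    rw [← Real.sqrt_mul (hδ n)]
    refine mul_le_mul_of_nonneg_left (Real.sqrt_le_sqrt ?_) (Real.sqrt_nonneg _)
    have ia : ∀ k, Integrable (P[ρ|𝓕 k]) P := fun k => integrable_condExp
    have hθabs : ∀ᵐ x ∂P, |θ n x| ≤ 1 := ae_of_all _ fun x => by
      rw [abs_of_nonneg (hθ01 n x).1]; exact (hθ01 n x).2
    have hθ2 : ∀ x, θ n x ^ 2 ∈ Icc (0 : ℝ) 1 := fun x =>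
      ⟨sq_nonneg _, pow_le_one₀ (hθ01 n x).1 (hθ01 n x).2⟩
    have hθ2abs : ∀ᵐ x ∂P, |θ n x ^ 2| ≤ 1 := ae_of_all _ fun x => by
      rw [abs_of_nonneg (hθ2 x).1]; exact (hθ2 x).2
    have e1 : ∫ x, θ n x ^ 2 * X n x ∂P = ∫ x, θ n x ^ 2 * (P[ρ|𝓕 n]) x ∂P :=
      integral_mul_condExp h𝒥 ((hθm' n).pow_const 2).stronglyMeasurable hθ2abs (ia n)
    have e2 : ∀ k, ∫ x, θ n x * X k x ∂P = ∫ x, θ n x * (P[ρ|𝓕 k]) x ∂P := fun k =>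
      integral_mul_condExp h𝒥 (hθm' n).stronglyMeasurable hθabs (ia k)
    have iθ : ∀ {f : Ω → ℝ}, Measurable f → (∀ᵐ x ∂P, f x ∈ Icc ε M) →
        Integrable (fun x => θ n x * f x) P := by
      intro f hf hfb
      refine integrable_of_abs_le (K := 1 * M) ((hθm n).mul hf).aestronglyMeasurable ?_
      filter_upwards [hfb] with x h1
      rw [abs_mul, abs_of_nonneg (hθ01 n x).1, abs_of_nonneg (hε.le.trans h1.1)]
      exact mul_le_mul (hθ01 n x).2 h1.2 (hε.le.trans h1.1) zero_le_one
    have hca : ∀ k, ∀ᵐ x ∂P, (P[ρ|𝓕 k]) x ∈ Icc ε M := fun k => ae_condExp_mem_Icc hρ hb (hle k)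
    have hcm : ∀ k, Measurable (P[ρ|𝓕 k]) := fun k => (stronglyMeasurable_condExp.mono (hle k)).measurable
    have e3 : ∫ x, θ n x ^ 2 * X n x ∂P = ∫ x, (θ n x * X n x - θ n x * X (n + 1) x) ∂P := by
      refine integral_congr_ae ?_
      filter_upwards [hXb n, hθeq n] with x h1 h2
      have hx : 0 < X n x := hε.trans_le h1.1
      rw [h2]
      rcases le_total 0 (1 - X (n + 1) x / X n x) with h | h
      · rw [max_eq_right h]; field_simp
      · rw [max_eq_left h]; ring
    have hK : ∫ x, (P[ρ|𝓕 n]) x * θ n x ^ 2 ∂P =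
        ∫ x, ((P[ρ|𝓕 n]) x - (P[ρ|𝓕 (n + 1)]) x) * θ n x ∂P := by
      calc ∫ x, (P[ρ|𝓕 n]) x * θ n x ^ 2 ∂P = ∫ x, θ n x ^ 2 * X n x ∂P := by
            rw [e1]; simp_rw [mul_comm]
        _ = (∫ x, θ n x * (P[ρ|𝓕 n]) x ∂P) - ∫ x, θ n x * (P[ρ|𝓕 (n + 1)]) x ∂P := by
            rw [e3, integral_sub (iθ (hXm _) (hXb _)) (iθ (hXm _) (hXb _)), e2, e2]
        _ = _ := by
            rw [← integral_sub (iθ (hcm _) (hca _)) (iθ (hcm _) (hca _))]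
            congr 1; ext x; ring
    calc ∫ x, (min 1 (X n x) * θ n x) ^ 2 ∂P ≤ ∫ x, θ n x ^ 2 * X n x ∂P := by
          refine integral_mono_ae (integrable_of_abs_le (K := 1)
            ((hsm n).pow_const 2).aestronglyMeasurable ?_)
            (integrable_of_abs_le (K := 1 * M)
              (((hθm n).pow_const 2).mul (hXm n)).aestronglyMeasurable ?_) ?_
          · filter_upwards [hsb n] with x h1
            rw [abs_of_nonneg (sq_nonneg _)]
            exact pow_le_one₀ h1.1 h1.2
          · filter_upwards [hXb n] with x h1
            rw [abs_mul, abs_of_nonneg (hθ2 x).1, abs_of_nonneg (hε.le.trans h1.1)]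
            exact mul_le_mul (hθ2 x).2 h1.2 (hε.le.trans h1.1) zero_le_one
          · filter_upwards [hXb n] with x h1
            have h2 : 0 ≤ min 1 (X n x) := le_min zero_le_one (hε.le.trans h1.1)
            have h3 : min 1 (X n x) ^ 2 ≤ X n x := by
              calc min 1 (X n x) ^ 2 = min 1 (X n x) * min 1 (X n x) := sq _
                _ ≤ 1 * X n x :=
                  mul_le_mul (min_le_left _ _) (min_le_right _ _) h2 zero_le_one
                _ = X n x := one_mul _
            change (min 1 (X n x) * θ n x) ^ 2 ≤ θ n x ^ 2 * X n x
            rw [mul_pow, mul_comm]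
            exact mul_le_mul_of_nonneg_left h3 (sq_nonneg _)
      _ = ∫ x, (P[ρ|𝓕 n]) x * θ n x ^ 2 ∂P := by rw [e1]; simp_rw [mul_comm]
      _ ≤ _ := integral_mul_sq_le_of_mixingBound hρ hε hb (hmono n.le_succ) (hle _) h𝒥 (hδ n)
          (hmix n hn) (hθm' n) (hθ01 n) hK
  calc ∫ x, g x * (1 - ρ x) ∂P = ∫ x, g x * (1 - X T x) ∂P := by
        simp_rw [mul_sub, mul_one]
        rw [integral_sub hgi (hgX hρ (ae_of_all _ hb)), integral_sub hgi (hgX (hXm T) (hXb T)),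
          hlast]
    _ ≤ ∫ x, ∑ n ∈ Finset.range T, g x * (min 1 (X n x) * θ n x) ∂P := by
        refine integral_mono_ae ?_ (integrable_finsetSum _ fun n _ => hgs n) ?_
        · simp_rw [mul_sub, mul_one]
          exact hgi.sub (hgX (hXm T) (hXb T))
        · filter_upwards [hpt] with x hx
          rw [← Finset.mul_sum]
          exact mul_le_mul_of_nonneg_left hx (hgN x).1
    _ = ∑ n ∈ Finset.range T, ∫ x, g x * (min 1 (X n x) * θ n x) ∂P :=
        integral_finsetSum _ fun n _ => hgs n
    _ ≤ _ := Finset.sum_le_sum fun n hn => hstep n (Finset.mem_range.1 hn)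

end Martingale

/-! ### The dependency matrix and the natural filtration on path space -/

section OpNorm

lemma sum_sum_mul_le_opNorm {n : ℕ} (A : Matrix (Fin n) (Fin n) ℝ) (a b : Fin n → ℝ) :
    ∑ j, ∑ i, a j * (A i j * b i) ≤ opNorm A * √(∑ j, a j ^ 2) * √(∑ i, b i ^ 2) := by
  have h1 : ∑ j, ∑ i, a j * (A i j * b i) =
      inner ℝ (WithLp.toLp 2 b) (Matrix.toEuclideanCLM (n := Fin n) (𝕜 := ℝ) A (WithLp.toLp 2 a)) := by
    rw [Matrix.toEuclideanCLM_toLp, PiLp.inner_apply, Finset.sum_comm]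
    refine Finset.sum_congr rfl fun i _ => ?_
    simp only [Matrix.mulVec, dotProduct, RCLike.inner_apply, conj_trivial, Finset.sum_mul]
    exact Finset.sum_congr rfl fun j _ => by ring
  have h2 : ∀ c : Fin n → ℝ, ‖(WithLp.toLp 2 c : EuclideanSpace ℝ (Fin n))‖ = √(∑ j, c j ^ 2) := by
    intro c
    rw [EuclideanSpace.norm_eq]
    simp
  rw [h1]
  refine (real_inner_le_norm _ _).trans ?_
  rw [h2 b, mul_comm]
  refine mul_le_mul_of_nonneg_right ?_ (Real.sqrt_nonneg _)
  rw [← h2 a]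
  exact ContinuousLinearMap.le_opNorm _ _

lemma opNorm_nonneg {n : ℕ} (A : Matrix (Fin n) (Fin n) ℝ) : 0 ≤ opNorm A := norm_nonneg _

lemma opNorm_pos {n : ℕ} {A : Matrix (Fin n) (Fin n) ℝ} (hA : A ≠ 0) : 0 < opNorm A := by
  refine norm_pos_iff.2 fun h => hA ?_
  exact (map_eq_zero_iff _ (Matrix.toEuclideanCLM (n := Fin n) (𝕜 := ℝ)).injective).1 h

end OpNorm

section PathSpace

variable {S : Type*} [MeasurableSpace S] {T : ℕ} {P : Measure (Fin T → S)}

/-- The σ-algebra on path space generated by the first `n` coordinates. -/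
abbrev pastSigma (T : ℕ) (S : Type*) [MeasurableSpace S] (n : ℕ) : MeasurableSpace (Fin T → S) :=
  ⨆ t : Fin T, ⨆ _ : (t : ℕ) < n, MeasurableSpace.comap (fun z : Fin T → S => z t) inferInstance

lemma pastSigma_zero : pastSigma T S 0 = ⊥ := by
  simp [pastSigma]

lemma pastSigma_mono : Monotone (pastSigma T S) := fun _ _ h =>
  iSup_mono fun _ => iSup_le fun h' => le_iSup_of_le (h'.trans_le h) le_rfl

lemma pastSigma_top : pastSigma T S T = MeasurableSpace.pi := by
  simp [pastSigma, MeasurableSpace.pi]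

lemma comap_eval_le_pastSigma (j : Fin T) {n : ℕ} (h : (j : ℕ) < n) :
    MeasurableSpace.comap (fun z : Fin T → S => z j) inferInstance ≤ pastSigma T S n :=
  le_iSup_of_le j (le_iSup_of_le h le_rfl)

lemma comap_eval_le (j : Fin T) :
    MeasurableSpace.comap (fun z : Fin T → S => z j) inferInstance ≤ MeasurableSpace.pi :=
  (measurable_pi_apply j).comap_le

lemma pastSigma_le (n : ℕ) : pastSigma T S n ≤ MeasurableSpace.pi :=
  iSup_le fun t => iSup_le fun _ => comap_eval_le t

lemma pastSigma_succ_le_comap_past (i : Fin T) :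
    pastSigma T S (i + 1) ≤ MeasurableSpace.comap (past i) inferInstance := by
  refine iSup_le fun t => iSup_le fun h => ?_
  have ht : t ∈ Set.Iic i := Nat.lt_succ_iff.1 h
  have : (fun z : Fin T → S => z t) = (fun w : Set.Iic i → S => w ⟨t, ht⟩) ∘ past i := rfl
  rw [this, ← MeasurableSpace.comap_comp]
  exact MeasurableSpace.comap_mono (measurable_pi_apply _).comap_le

lemma measurable_future (j : Fin T) : Measurable (future j : (Fin T → S) → _) :=
  measurable_pi_lambda _ fun _ => measurable_pi_apply _

lemma abs_measureReal_sub_le_one {R : Type*} [MeasurableSpace R] (ν ν' : Measure R)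
    [IsProbabilityMeasure ν] [IsProbabilityMeasure ν'] (B : Set R) :
    |ν.real B - ν'.real B| ≤ 1 := by
  have h1 : ν.real B ≤ 1 := measureReal_le_one
  have h2 : ν'.real B ≤ 1 := measureReal_le_one
  have h3 : 0 ≤ ν.real B := measureReal_nonneg
  have h4 : 0 ≤ ν'.real B := measureReal_nonneg
  exact abs_le.2 ⟨by linarith, by linarith⟩

lemma tvDist_le_one {R : Type*} [MeasurableSpace R] (ν ν' : Measure R)
    [IsProbabilityMeasure ν] [IsProbabilityMeasure ν'] : tvDist ν ν' ≤ 1 :=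
  Real.sSup_le (by rintro d ⟨B, -, rfl⟩; exact abs_measureReal_sub_le_one ν ν' B) zero_le_one

lemma abs_measureReal_sub_le_tvDist {R : Type*} [MeasurableSpace R] (ν ν' : Measure R)
    [IsProbabilityMeasure ν] [IsProbabilityMeasure ν'] {B : Set R} (hB : MeasurableSet B) :
    |ν.real B - ν'.real B| ≤ tvDist ν ν' :=
  le_csSup ⟨1, by rintro d ⟨B, -, rfl⟩; exact abs_measureReal_sub_le_one ν ν' B⟩ ⟨B, hB, rfl⟩

lemma tvDist_nonneg {R : Type*} [MeasurableSpace R] (ν ν' : Measure R) : 0 ≤ tvDist ν ν' :=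
  Real.sSup_nonneg (by rintro d ⟨B, -, rfl⟩; exact abs_nonneg _)

lemma depCoeff_nonneg (i j : Fin T) : 0 ≤ depCoeff P i j :=
  Real.sSup_nonneg (by rintro d ⟨A, -, -, rfl⟩; exact tvDist_nonneg _ _)

lemma depMatrix_nonneg (i j : Fin T) : 0 ≤ depMatrix P i j := by
  simp only [depMatrix, Matrix.of_apply]
  split_ifs
  · exact Real.sqrt_nonneg _
  · exact zero_le_one
  · exact le_rfl

lemma opNorm_depMatrix_pos (hT : 0 < T) : 0 < opNorm (depMatrix P) := by
  refine opNorm_pos fun h => ?_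
  have : depMatrix P ⟨0, hT⟩ ⟨0, hT⟩ = 0 := by rw [h]; rfl
  simp [depMatrix] at this

variable [IsProbabilityMeasure P]

lemma tvDist_cond_le_depCoeff (i j : Fin T) {A : Set (Fin T → S)}
    (hA : MeasurableSet[MeasurableSpace.comap (past i) inferInstance] A) (hA0 : P A ≠ 0) :
    tvDist ((P[|A]).map (future j)) (P.map (future j)) ≤ depCoeff P i j := by
  have := Measure.isProbabilityMeasure_map (μ := P) (measurable_future j).aemeasurable
  refine le_csSup ⟨1, ?_⟩ ⟨A, hA, hA0, rfl⟩
  rintro d ⟨A, -, hA0, rfl⟩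
  have := cond_isProbabilityMeasure hA0
  have := Measure.isProbabilityMeasure_map (μ := P[|A]) (measurable_future j).aemeasurable
  exact tvDist_le_one _ _

lemma measureReal_cond_future_sub_le (i j : Fin T) {A A' : Set (Fin T → S)}
    (hA : MeasurableSet[MeasurableSpace.comap (past i) inferInstance] A) (hA0 : P A ≠ 0)
    (hA' : MeasurableSet[MeasurableSpace.comap (past i) inferInstance] A') (hA'0 : P A' ≠ 0)
    {B : Set (Set.Ici j → S)} (hB : MeasurableSet B) :
    ((P[|A]).map (future j)).real B - ((P[|A']).map (future j)).real B ≤ 2 * depCoeff P i j := by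
  have := Measure.isProbabilityMeasure_map (μ := P) (measurable_future j).aemeasurable
  have := cond_isProbabilityMeasure hA0
  have := cond_isProbabilityMeasure hA'0
  have := Measure.isProbabilityMeasure_map (μ := P[|A]) (measurable_future j).aemeasurable
  have := Measure.isProbabilityMeasure_map (μ := P[|A']) (measurable_future j).aemeasurable
  have h1 := (abs_measureReal_sub_le_tvDist ((P[|A]).map (future j)) (P.map (future j)) hB).trans
    (tvDist_cond_le_depCoeff i j hA hA0)
  have h2 := (abs_measureReal_sub_le_tvDist ((P[|A']).map (future j)) (P.map (future j)) hB).trans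
    (tvDist_cond_le_depCoeff i j hA' hA'0)
  linarith [(abs_le.1 h1).2, (abs_le.1 h2).1]

/-- For `i < j` the dependency coefficient bounds the effect of the past up to `i` on the `j`-th
coordinate. Two conditionings on the past are compared through the unconditional law, which accounts
for the factor `2`. -/
lemma mixingBound_depCoeff (i j : Fin T) :
    MixingBound P (pastSigma T S i) (pastSigma T S (i + 1))
      (MeasurableSpace.comap (fun z : Fin T → S => z j) inferInstance)
      (2 * depCoeff P i j) := by
  intro θ hθ h01
  obtain ⟨t, ht, rfl⟩ := hθ.exists_eq_measurable_comp
  have htm : Measurable (t ∘ fun z : Fin T → S => z j) := ht.comp (measurable_pi_apply j)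
  have hcmp : ∀ A A', MeasurableSet[pastSigma T S (i + 1)] A →
      MeasurableSet[pastSigma T S (i + 1)] A' → P A ≠ 0 → P A' ≠ 0 → ∀ s : ℝ, 0 < s →
      (∫ z, (t ∘ fun z : Fin T → S => z j) z ∂P[|A]) -
        ∫ z, (t ∘ fun z : Fin T → S => z j) z ∂P[|A'] ≤ 2 * depCoeff P i j * s / 2 +
        (∫ z, (t ∘ fun z : Fin T → S => z j) z ^ 2 ∂P[|A]) / (2 * s) := by
    intro A A' hA hA' hA0 hA'0 s hs
    have hA := pastSigma_succ_le_comap_past i _ hA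
    have hA' := pastSigma_succ_le_comap_past i _ hA'
    have := cond_isProbabilityMeasure hA0
    have := cond_isProbabilityMeasure hA'0
    have hfut := measurable_future (S := S) j
    have := Measure.isProbabilityMeasure_map (μ := P[|A]) hfut.aemeasurable
    have := Measure.isProbabilityMeasure_map (μ := P[|A']) hfut.aemeasurable
    -- `t` is read off the first coordinate of the future; it is truncated to take values in `[0, 1]`
    -- also outside the range of the coordinate map
    set u : (Set.Ici j → S) → ℝ := fun w => max 0 (min 1 (t (w ⟨j, Set.self_mem_Ici⟩))) with hu
    have hum : Measurable u := measurable_const.max (measurable_const.min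
      (ht.comp (measurable_pi_apply _)))
    have hut : ∀ z : Fin T → S, u (future j z) = t (z j) := by
      intro z
      have := h01 z
      simp only [Function.comp_apply] at this
      simp only [hu, future]
      rw [min_eq_right this.2, max_eq_right this.1]
    have h := integral_sub_integral_le_of_measure_sub_le
      (fun B hB => measureReal_cond_future_sub_le i j hA hA0 hA' hA'0 hB) hum
      (fun w => ⟨le_max_left _ _, max_le zero_le_one (min_le_left _ _)⟩) hs
    rw [integral_map hfut.aemeasurable hum.aestronglyMeasurable,
      integral_map hfut.aemeasurable hum.aestronglyMeasurable,
      integral_map hfut.aemeasurable (hum.pow_const 2).aestronglyMeasurable] at h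
    simpa only [hut, Function.comp_apply] using h
  obtain ⟨c, hc, hc'⟩ := exists_const_sq_condExp_sub_le (P := P) (pastSigma_le (i + 1)) htm h01
    (mul_nonneg zero_le_two (depCoeff_nonneg (P := P) i j)) hcmp
  exact ⟨fun _ => c, stronglyMeasurable_const, ae_of_all _ fun _ => hc, hc'⟩

lemma mixingBound_depMatrix (i j : Fin T) :
    MixingBound P (pastSigma T S i) (pastSigma T S (i + 1))
      (MeasurableSpace.comap (fun z : Fin T → S => z j) inferInstance)
      (depMatrix P i j ^ 2) := by
  simp only [depMatrix, Matrix.of_apply]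
  split_ifs with h1 h2
  · rw [Real.sq_sqrt (mul_nonneg zero_le_two (depCoeff_nonneg i j))]
    exact mixingBound_depCoeff i j
  · rw [one_pow]
    exact mixingBound_one (pastSigma_le _) (comap_eval_le_pastSigma j (n := i + 1) (by omega))
  · rw [zero_pow two_ne_zero]
    exact mixingBound_zero (pastSigma_le _) (pastSigma_mono (Nat.le_succ _))
      (comap_eval_le_pastSigma j (n := i) (by omega))

/-! ### The transport–entropy inequality and the Laplace transform -/

/-- Asymmetric transport–entropy inequality for additive functionals: the decrease of the mean of
`∑ g (z_t)` under a change of measure is controlled by the relative entropy, the second moments of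
`g` under the original measure, and the operator norm of the dependency matrix. -/
lemma sum_integral_mul_one_sub_le {ρ : (Fin T → S) → ℝ} {ε M : ℝ} (hρ : Measurable ρ) (hε : 0 < ε)
    (hb : ∀ x, ρ x ∈ Icc ε M) (hρ1 : ∫ x, ρ x ∂P = 1) {g : S → ℝ} (hg : Measurable g) {N : ℝ}
    (hgN : ∀ x, g x ∈ Icc 0 N) :
    ∑ j, ∫ z, g (z j) * (1 - ρ z) ∂P ≤
      opNorm (depMatrix P) * √(∑ j, ∫ z, g (z j) ^ 2 ∂P) *
        √(2 * ∫ z, ρ z * Real.log (ρ z) ∂P) := by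
  set B : ℕ → ℝ := fun n => incrementEnergy P ρ (pastSigma T S n) (pastSigma T S (n + 1)) with hB
  have hB0 : ∀ n, 0 ≤ B n := fun n => incrementEnergy_nonneg hρ hε hb (pastSigma_le n)
  have hρT : Measurable[pastSigma T S T] ρ := by rw [pastSigma_top]; exact hρ
  have hent : ∑ i : Fin T, B i ≤ 2 * ∫ z, ρ z * Real.log (ρ z) ∂P := by
    rw [Fin.sum_univ_eq_sum_range B T]
    exact sum_incrementEnergy_le hρ hε hb hρ1 pastSigma_mono pastSigma_le pastSigma_zero hρT
  have hj : ∀ j : Fin T, ∫ z, g (z j) * (1 - ρ z) ∂P ≤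
      ∑ i : Fin T, √(∫ z, g (z j) ^ 2 ∂P) * (depMatrix P i j * √(B i)) := by
    intro j
    have hδ : ∀ n : ℕ, 0 ≤ (if h : n < T then depMatrix P ⟨n, h⟩ j ^ 2 else 0) := fun n => by
      split_ifs <;> positivity
    have h := integral_mul_one_sub_le_sum (P := P) hρ hε hb hρ1 pastSigma_mono pastSigma_le
      pastSigma_zero hρT (comap_eval_le j)
      (δ := fun n => if h : n < T then depMatrix P ⟨n, h⟩ j ^ 2 else 0)
      hδ
      (fun n hn => by
        simp only [hn, dif_pos]
        exact mixingBound_depMatrix ⟨n, hn⟩ j)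
      (g := fun z => g (z j)) (hg.comp (comap_measurable _)) (fun z => hgN (z j))
    rw [← Fin.sum_univ_eq_sum_range (fun n => √(∫ z, g (z j) ^ 2 ∂P) *
      (√(if h : n < T then depMatrix P ⟨n, h⟩ j ^ 2 else 0) * √(B n))) T] at h
    simpa only [Fin.is_lt, dif_pos, Fin.eta, Real.sqrt_sq (depMatrix_nonneg _ _)] using h
  refine (Finset.sum_le_sum fun j _ => hj j).trans ?_
  refine (sum_sum_mul_le_opNorm (depMatrix P) _ _).trans ?_
  have e1 : ∀ j : Fin T, √(∫ z, g (z j) ^ 2 ∂P) ^ 2 = ∫ z, g (z j) ^ 2 ∂P := fun j =>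
    Real.sq_sqrt (integral_nonneg fun z => sq_nonneg _)
  simp_rw [e1, Real.sq_sqrt (hB0 _)]
  exact mul_le_mul_of_nonneg_left (Real.sqrt_le_sqrt hent)
    (mul_nonneg (opNorm_nonneg _) (Real.sqrt_nonneg _))

/-- Laplace transform of the lower tail, by applying the transport–entropy inequality to the
Gibbs measure with density proportional to `exp (-s ∑ g (z_t))`. -/
lemma integral_exp_neg_sum_le {g : S → ℝ} (hg : Measurable g) {N : ℝ}
    (hgN : ∀ x, g x ∈ Icc 0 N) {s : ℝ} (hs : 0 ≤ s) :
    ∫ z, Real.exp (-s * ∑ j, g (z j)) ∂P ≤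
      Real.exp (-s * ∑ j, ∫ z, g (z j) ∂P +
        s ^ 2 * opNorm (depMatrix P) ^ 2 * (∑ j, ∫ z, g (z j) ^ 2 ∂P) / 2) := by
  have hgm : ∀ j : Fin T, Measurable fun z : Fin T → S => g (z j) := fun j =>
    hg.comp (measurable_pi_apply j)
  have hFm : Measurable fun z : Fin T → S => ∑ j, g (z j) :=
    Finset.measurable_sum _ fun j _ => hgm j
  have hFb : ∀ z : Fin T → S, ∑ j, g (z j) ∈ Icc (0 : ℝ) (T * N) := by
    intro z
    refine ⟨Finset.sum_nonneg fun j _ => (hgN _).1, ?_⟩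
    calc ∑ j, g (z j) ≤ ∑ _j : Fin T, N := Finset.sum_le_sum fun j _ => (hgN _).2
      _ = T * N := by simp
  have hFi : Integrable (fun z : Fin T → S => ∑ j, g (z j)) P := integrable_of_mem_Icc hFm hFb
  have hgi : ∀ j : Fin T, Integrable (fun z : Fin T → S => g (z j)) P := fun j =>
    integrable_of_mem_Icc (hgm j) fun z => hgN _
  set Z := ∫ z, Real.exp (-s * ∑ j, g (z j)) ∂P with hZ
  have hEm : Measurable fun z : Fin T → S => Real.exp (-s * ∑ j, g (z j)) :=
    (hFm.const_mul _).exp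
  have hEb : ∀ z : Fin T → S, Real.exp (-s * ∑ j, g (z j)) ∈ Icc (Real.exp (-s * (T * N))) 1 := by
    intro z
    refine ⟨Real.exp_le_exp.2 ?_, Real.exp_le_one_iff.2 ?_⟩
    · nlinarith [mul_le_mul_of_nonneg_left (hFb z).2 hs]
    · nlinarith [mul_nonneg hs (hFb z).1]
  have hEi : Integrable (fun z : Fin T → S => Real.exp (-s * ∑ j, g (z j))) P :=
    integrable_of_mem_Icc hEm hEb
  have hZ0 : 0 < Z := integral_exp_pos hEi
  set ρ : (Fin T → S) → ℝ := fun z => Real.exp (-s * ∑ j, g (z j)) / Z with hρdef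
  have hρm : Measurable ρ := hEm.div_const _
  have hρb : ∀ z, ρ z ∈ Icc (Real.exp (-s * (T * N)) / Z) (1 / Z) := fun z =>
    ⟨div_le_div_of_nonneg_right (hEb z).1 hZ0.le, div_le_div_of_nonneg_right (hEb z).2 hZ0.le⟩
  have hρ1 : ∫ z, ρ z ∂P = 1 := by
    simp only [hρdef]
    rw [integral_div, ← hZ, div_self hZ0.ne']
  have hε : 0 < Real.exp (-s * (T * N)) / Z := div_pos (Real.exp_pos _) hZ0
  have htr := sum_integral_mul_one_sub_le hρm hε hρb hρ1 hg hgN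
  have hent0 : 0 ≤ 2 * ∫ z, ρ z * Real.log (ρ z) ∂P :=
    (Finset.sum_nonneg fun n _ => incrementEnergy_nonneg hρm hε hρb (pastSigma_le n)).trans
      (sum_incrementEnergy_le hρm hε hρb hρ1 pastSigma_mono pastSigma_le pastSigma_zero
        (T := T) (by rw [pastSigma_top]; exact hρm))
  have hgρ : ∀ j : Fin T, Integrable (fun z => g (z j) * ρ z) P := by
    intro j
    refine integrable_of_mem_Icc (ε := 0) (M := N * (1 / Z)) ((hgm j).mul hρm) fun z => ?_
    have h1 := hε.le.trans (hρb z).1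
    exact ⟨mul_nonneg (hgN _).1 h1,
      mul_le_mul (hgN _).2 (hρb z).2 h1 ((hgN (z j)).1.trans (hgN (z j)).2)⟩
  have hsplit : ∑ j, ∫ z, g (z j) * (1 - ρ z) ∂P =
      (∑ j, ∫ z, g (z j) ∂P) - ∑ j, ∫ z, g (z j) * ρ z ∂P := by
    rw [← Finset.sum_sub_distrib]
    refine Finset.sum_congr rfl fun j _ => ?_
    rw [← integral_sub (hgi j) (hgρ j)]
    congr 1; ext z; ring
  have hρi := integrable_of_mem_Icc (P := P) hρm hρb
  have hentZ : ∫ z, ρ z * Real.log (ρ z) ∂P =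
      -s * (∑ j, ∫ z, g (z j) * ρ z ∂P) - Real.log Z := by
    calc ∫ z, ρ z * Real.log (ρ z) ∂P
        = ∫ z, (-s * (∑ j, g (z j) * ρ z) - Real.log Z * ρ z) ∂P := by
          congr 1; ext z
          have : Real.log (ρ z) = -s * ∑ j, g (z j) - Real.log Z := by
            simp only [hρdef]
            rw [Real.log_div (Real.exp_pos _).ne' hZ0.ne', Real.log_exp]
          rw [this, ← Finset.sum_mul]
          ring
      _ = _ := by
          rw [integral_sub ((integrable_finsetSum _ fun j _ => hgρ j).const_mul _)
            (hρi.const_mul _), integral_const_mul, integral_const_mul,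
            integral_finsetSum _ fun j _ => hgρ j, hρ1, mul_one]
  rw [← Real.exp_log hZ0]
  refine Real.exp_le_exp.2 ?_
  set H := ∫ z, ρ z * Real.log (ρ z) ∂P
  set V := ∑ j, ∫ z, g (z j) ^ 2 ∂P with hV
  have hV0 : 0 ≤ V := Finset.sum_nonneg fun j _ => integral_nonneg fun z => sq_nonneg _
  set G := opNorm (depMatrix P)
  rw [hsplit] at htr
  have h1 := mul_le_mul_of_nonneg_left htr hs
  have h2 := sq_nonneg (s * G * √V - √(2 * H))
  have h3 : (s * G * √V - √(2 * H)) ^ 2 =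
      s ^ 2 * G ^ 2 * V - 2 * (s * (G * √V * √(2 * H))) + 2 * H := by
    rw [sub_sq, mul_pow, mul_pow, Real.sq_sqrt hV0, Real.sq_sqrt hent0]; ring
  rw [h3] at h2
  linarith

/-- Chernoff's bound for the lower tail of an additive functional of bounded summands. -/
lemma measureReal_sum_le_exp {g : S → ℝ} (hg : Measurable g) {N : ℝ}
    (hgN : ∀ x, g x ∈ Icc 0 N) {s : ℝ} (hs : 0 ≤ s) (a : ℝ) :
    P.real {z | ∑ j, g (z j) ≤ a} ≤
      Real.exp (s * a - s * ∑ j, ∫ z, g (z j) ∂P +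
        s ^ 2 * opNorm (depMatrix P) ^ 2 * (∑ j, ∫ z, g (z j) ^ 2 ∂P) / 2) := by
  have hFm : Measurable fun z : Fin T → S => ∑ j, g (z j) :=
    Finset.measurable_sum _ fun j _ => hg.comp (measurable_pi_apply j)
  have hi : Integrable (fun z : Fin T → S => Real.exp (-s * ∑ j, g (z j))) P := by
    refine integrable_of_mem_Icc (ε := 0) (M := 1) (hFm.const_mul _).exp fun z =>
      ⟨(Real.exp_pos _).le, Real.exp_le_one_iff.2 ?_⟩
    have : 0 ≤ ∑ j, g (z j) := Finset.sum_nonneg fun j _ => (hgN _).1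
    nlinarith [mul_nonneg hs this]
  have h := measure_le_le_exp_mul_mgf (μ := P) (X := fun z : Fin T → S => ∑ j, g (z j)) a
    (t := -s) (by linarith) hi
  refine h.trans ?_
  rw [mgf, neg_neg]
  refine (mul_le_mul_of_nonneg_left (integral_exp_neg_sum_le hg hgN hs) (Real.exp_pos _).le).trans ?_
  rw [← Real.exp_add]
  exact Real.exp_le_exp.2 (by linarith)

/-- Lower tail of an additive functional of square integrable summands. The bound for the
truncations `min (g, N)` passes to the limit since only their means have to converge. -/
lemma measureReal_sum_le_half_le_exp (hT : 0 < T) {g : S → ℝ} (hg : Measurable g)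
    (hg0 : ∀ x, 0 ≤ g x) (hgi : ∀ j, Integrable (fun z : Fin T → S => g (z j)) P)
    (hg2i : ∀ j, Integrable (fun z : Fin T → S => g (z j) ^ 2) P) {m v : ℝ} (hm : 0 ≤ m)
    (hv : 0 < v) (hgm : m = ∑ j, ∫ z, g (z j) ∂P) (hgv : ∑ j, ∫ z, g (z j) ^ 2 ∂P ≤ v) :
    P.real {z | ∑ j, g (z j) ≤ m / 2} ≤
      Real.exp (-(m ^ 2 / (8 * opNorm (depMatrix P) ^ 2 * v))) := by
  set G := opNorm (depMatrix P)
  have hG : 0 < G := opNorm_depMatrix_pos hT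
  -- the minimizer of the exponent `-s m / 2 + s² G² v / 2`
  set s := m / (2 * G ^ 2 * v) with hs
  have hs0 : 0 ≤ s := by positivity
  have hN : ∀ N : ℕ, P.real {z | ∑ j, g (z j) ≤ m / 2} ≤
      Real.exp (s * (m / 2) - s * ∑ j, ∫ z, min (g (z j)) N ∂P + s ^ 2 * G ^ 2 * v / 2) := by
    intro N
    have hNm : Measurable fun x => min (g x) (N : ℝ) := hg.min measurable_const
    have hNb : ∀ x, min (g x) (N : ℝ) ∈ Icc (0 : ℝ) N := fun x =>
      ⟨le_min (hg0 x) N.cast_nonneg, min_le_right _ _⟩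
    calc P.real {z | ∑ j, g (z j) ≤ m / 2} ≤ P.real {z | ∑ j, min (g (z j)) (N : ℝ) ≤ m / 2} := by
          refine measureReal_mono fun z hz => ?_
          have h1 : ∑ j, min (g (z j)) (N : ℝ) ≤ ∑ j, g (z j) :=
            Finset.sum_le_sum fun j _ => min_le_left _ _
          exact h1.trans hz
      _ ≤ _ := measureReal_sum_le_exp hNm hNb hs0 (m / 2)
      _ ≤ _ := by
          refine Real.exp_le_exp.2 ?_
          have h1 : ∑ j, ∫ z, min (g (z j)) (N : ℝ) ^ 2 ∂P ≤ v := by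
            refine (Finset.sum_le_sum fun j _ => ?_).trans hgv
            refine integral_mono_of_nonneg (ae_of_all _ fun z => sq_nonneg _) (hg2i j)
              (ae_of_all _ fun z => ?_)
            exact pow_le_pow_left₀ (hNb _).1 (min_le_left _ _) 2
          have h2 := mul_le_mul_of_nonneg_left h1 (by positivity : 0 ≤ s ^ 2 * G ^ 2)
          linarith
  have hlim : Filter.Tendsto (fun N : ℕ => ∑ j, ∫ z, min (g (z j)) (N : ℝ) ∂P) Filter.atTop
      (nhds (∑ j, ∫ z, g (z j) ∂P)) := by
    refine tendsto_finsetSum _ fun j _ => ?_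
    refine tendsto_integral_of_dominated_convergence (fun z => g (z j)) (fun N => ?_) (hgi j)
      (fun N => ae_of_all _ fun z => ?_) (ae_of_all _ fun z => ?_)
    · exact ((hg.comp (measurable_pi_apply j)).min measurable_const).aestronglyMeasurable
    · rw [Real.norm_eq_abs, abs_of_nonneg (le_min (hg0 _) N.cast_nonneg)]
      exact min_le_left _ _
    · refine tendsto_const_nhds.congr' ?_
      obtain ⟨N₀, hN₀⟩ := exists_nat_ge (g (z j))
      filter_upwards [Filter.eventually_ge_atTop N₀] with N hN
      rw [min_eq_left (hN₀.trans (by exact_mod_cast hN))]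
  rw [← hgm] at hlim
  have hlim2 := (Real.continuous_exp.tendsto _).comp
    (((tendsto_const_nhds (x := s * (m / 2))).sub (hlim.const_mul s)).add
      (tendsto_const_nhds (x := s ^ 2 * G ^ 2 * v / 2)))
  refine (ge_of_tendsto' hlim2 hN).trans (Real.exp_le_exp.2 (le_of_eq ?_))
  rw [hs]
  field_simp
  ring

end PathSpace

/-! ### Empirical norms, moments and the net argument -/

section Trajectory

variable {Ω D E : Type*} [NormedAddCommGroup E] {T : ℕ}

lemma inv_natCast_eq_ofReal (hT : 0 < T) : (T : ℝ≥0∞)⁻¹ = ENNReal.ofReal ((T : ℝ)⁻¹) := by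
  rw [ENNReal.ofReal_inv_of_pos (by exact_mod_cast hT), ENNReal.ofReal_natCast]

lemma empSq_eq_ofReal (hT : 0 < T) (X : Fin T → Ω → D) (f : D → E) (ω : Ω) :
    empSq X f ω = ENNReal.ofReal ((T : ℝ)⁻¹ * ∑ t, ‖f (X t ω)‖ ^ 2) := by
  rw [empSq, ENNReal.ofReal_mul (by positivity), inv_natCast_eq_ofReal hT,
    ENNReal.ofReal_sum_of_nonneg fun t _ => sq_nonneg _]
  simp_rw [ENNReal.ofReal_pow (norm_nonneg _), ofReal_norm]

lemma empSq_smul [NormedSpace ℝ E] (X : Fin T → Ω → D) (c : ℝ) (f : D → E) (ω : Ω) :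
    empSq X (c • f) ω = ‖c‖ₑ ^ 2 * empSq X f ω := by
  simp only [empSq, Pi.smul_apply, enorm_smul, mul_pow]
  rw [← Finset.mul_sum, mul_left_comm]

/-- Replacing a function by a point of a net at distance `d` costs a factor `2` and an additive
`2 d²` in the empirical squared norm. -/
lemma empSq_le_of_supNorm_le (hT : 0 < T) {𝒳 : Set D} {X : Fin T → Ω → D}
    (hX𝒳 : ∀ t ω, X t ω ∈ 𝒳) {f g : D → E} {d a : ℝ} (hd : 0 ≤ d)
    (h : supNorm 𝒳 (f - g) ≤ ENNReal.ofReal d) {ω : Ω} (ha : 0 ≤ a)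
    (hf : empSq X f ω ≤ ENNReal.ofReal a) :
    empSq X g ω ≤ ENNReal.ofReal (2 * a + 2 * d ^ 2) := by
  have hT' : (0 : ℝ) < T := by exact_mod_cast hT
  rw [empSq_eq_ofReal hT] at hf ⊢
  rw [ENNReal.ofReal_le_ofReal_iff ha] at hf
  refine ENNReal.ofReal_le_ofReal ?_
  have hpt : ∀ t, ‖g (X t ω)‖ ^ 2 ≤ 2 * ‖f (X t ω)‖ ^ 2 + 2 * d ^ 2 := by
    intro t
    have h1 : ‖(f - g) (X t ω)‖ₑ ≤ ENNReal.ofReal d :=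
      (le_iSup₂ (f := fun x (_ : x ∈ 𝒳) => ‖(f - g) x‖ₑ) (X t ω) (hX𝒳 t ω)).trans h
    rw [← ofReal_norm, ENNReal.ofReal_le_ofReal_iff hd, Pi.sub_apply] at h1
    have h2 : ‖g (X t ω)‖ ≤ ‖f (X t ω)‖ + d := by
      have := norm_sub_norm_le (g (X t ω)) (f (X t ω))
      rw [norm_sub_rev] at this
      linarith
    have h3 := pow_le_pow_left₀ (norm_nonneg _) h2 2
    nlinarith [sq_nonneg (‖f (X t ω)‖ - d)]
  rw [inv_mul_le_iff₀ hT'] at hf ⊢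
  calc ∑ t, ‖g (X t ω)‖ ^ 2 ≤ ∑ t, (2 * ‖f (X t ω)‖ ^ 2 + 2 * d ^ 2) :=
        Finset.sum_le_sum fun t _ => hpt t
    _ = 2 * ∑ t, ‖f (X t ω)‖ ^ 2 + T * (2 * d ^ 2) := by
        rw [Finset.sum_add_distrib, Finset.mul_sum]; simp
    _ ≤ T * (2 * a + 2 * d ^ 2) := by linarith

variable [MeasurableSpace Ω]

lemma moment_two_smul [NormedSpace ℝ E] (μ : Measure Ω) (X : Fin T → Ω → D) (c : ℝ) (f : D → E) :
    moment μ X 2 (c • f) = ‖c‖ₑ ^ 2 * moment μ X 2 f := by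
  simp only [moment, Pi.smul_apply, enorm_smul, mul_pow]
  simp_rw [lintegral_const_mul' _ _ (ENNReal.pow_ne_top enorm_ne_top : ‖c‖ₑ ^ 2 ≠ ∞)]
  rw [← Finset.mul_sum, mul_left_comm]

/-- Star-shapedness rescales a failure of the lower isometry outside the ball to a failure on its
boundary. -/
lemma exists_mem_sphere_empSq_le [NormedSpace ℝ E] {μ : Measure Ω} {X : Fin T → Ω → D}
    {G : Set (D → E)} (hstar : StarConvex ℝ 0 G) {r : ℝ} {f : D → E}
    (hf : f ∈ G \ ball μ X G r) (hfin : moment μ X 2 f < ∞) {ω : Ω}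
    (hω : empSq X f ω ≤ (1 / 8) * moment μ X 2 f) :
    ∃ h ∈ sphere μ X G r, empSq X h ω ≤ ENNReal.ofReal (r ^ 2 / 8) := by
  obtain ⟨hfG, hfb⟩ := hf
  have hlt : ENNReal.ofReal (r ^ 2) < moment μ X 2 f := not_le.1 fun h => hfb ⟨hfG, h⟩
  obtain ⟨R, hR0, hR⟩ : ∃ R : ℝ, 0 ≤ R ∧ moment μ X 2 f = ENNReal.ofReal (R ^ 2) := by
    refine ⟨√(moment μ X 2 f).toReal, Real.sqrt_nonneg _, ?_⟩
    rw [Real.sq_sqrt ENNReal.toReal_nonneg, ENNReal.ofReal_toReal hfin.ne]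
  rw [hR] at hlt hω
  have hlt' : r ^ 2 < R ^ 2 := (ENNReal.ofReal_lt_ofReal_iff'.1 hlt).1
  have hRpos : 0 < R := by
    rcases hR0.eq_or_lt with h | h
    · rw [← h] at hlt'; nlinarith [sq_nonneg r]
    · exact h
  have habs : |r| ≤ R := by
    have := Real.sqrt_le_sqrt hlt'.le
    rwa [Real.sqrt_sq_eq_abs, Real.sqrt_sq hR0] at this
  have hc : ‖|r| / R‖ₑ ^ 2 * ENNReal.ofReal (R ^ 2) = ENNReal.ofReal (r ^ 2) := by
    rw [Real.enorm_of_nonneg (by positivity), ← ENNReal.ofReal_pow (by positivity),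
      ← ENNReal.ofReal_mul (by positivity), div_pow, sq_abs, div_mul_cancel₀ _ (by positivity)]
  refine ⟨(|r| / R) • f, ⟨hstar.smul_mem hfG (by positivity) ((div_le_one hRpos).2 habs), ?_⟩, ?_⟩
  · rw [moment_two_smul, hR, hc]
  · rw [empSq_smul]
    calc ‖|r| / R‖ₑ ^ 2 * empSq X f ω ≤ ‖|r| / R‖ₑ ^ 2 * ((1 / 8) * ENNReal.ofReal (R ^ 2)) := by
          gcongr
      _ = (1 / 8) * ENNReal.ofReal (r ^ 2) := by rw [mul_left_comm, hc]
      _ = ENNReal.ofReal (r ^ 2 / 8) := by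
          rw [ENNReal.ofReal_div_of_pos (by norm_num), one_div, mul_comm, ← div_eq_mul_inv]
          norm_num

lemma integrable_and_sum_integral_eq (hT : 0 < T) {μ : Measure Ω} {h : Fin T → Ω → ℝ}
    (hm : ∀ t, Measurable (h t)) (h0 : ∀ t ω, 0 ≤ h t ω)
    (hfin : (T : ℝ≥0∞)⁻¹ * ∑ t, ∫⁻ ω, ENNReal.ofReal (h t ω) ∂μ ≠ ∞) :
    (∀ t, Integrable (h t) μ) ∧ ∑ t, ∫ ω, h t ω ∂μ =
      T * ((T : ℝ≥0∞)⁻¹ * ∑ t, ∫⁻ ω, ENNReal.ofReal (h t ω) ∂μ).toReal := by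
  have hT' : (T : ℝ) ≠ 0 := by exact_mod_cast hT.ne'
  have hTinv : (T : ℝ≥0∞)⁻¹ ≠ 0 := ENNReal.inv_ne_zero.2 (ENNReal.natCast_ne_top T)
  have hsum : ∑ t, ∫⁻ ω, ENNReal.ofReal (h t ω) ∂μ ≠ ∞ := fun h =>
    hfin (by rw [h, ENNReal.mul_top hTinv])
  have hne : ∀ t, ∫⁻ ω, ENNReal.ofReal (h t ω) ∂μ ≠ ∞ := fun t =>
    (ENNReal.sum_ne_top.1 hsum) t (Finset.mem_univ t)
  refine ⟨fun t => ?_, ?_⟩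
  · exact (lintegral_ofReal_ne_top_iff_integrable (hm t).aestronglyMeasurable
      (ae_of_all _ (h0 t))).1 (hne t)
  · rw [ENNReal.toReal_mul, ENNReal.toReal_inv, ENNReal.toReal_natCast, mul_inv_cancel_left₀ hT',
      ENNReal.toReal_sum fun t _ => hne t]
    refine Finset.sum_congr rfl fun t _ => ?_
    exact integral_eq_lintegral_of_nonneg_ae (ae_of_all _ (h0 t)) (hm t).aestronglyMeasurable

lemma exists_measurable_eqOn_norm_sq [MeasurableSpace D] [MeasurableSpace E]
    [OpensMeasurableSpace E] {𝒳 : Set D} {f : D → E} (hf : Measurable (𝒳.domRestrict f)) :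
    ∃ g : D → ℝ, Measurable g ∧ (∀ x, 0 ≤ g x) ∧ ∀ x ∈ 𝒳, g x = ‖f x‖ ^ 2 := by
  have hm : Measurable[MeasurableSpace.comap (Subtype.val : 𝒳 → D) inferInstance]
      (fun x : 𝒳 => ‖𝒳.domRestrict f x‖ ^ 2) := hf.norm.pow_const 2
  obtain ⟨u, hu, hfu⟩ := hm.exists_eq_measurable_comp
  refine ⟨fun x => max 0 (u x), measurable_const.max hu, fun x => le_max_left _ _, fun x hx => ?_⟩
  have h1 : ‖f x‖ ^ 2 = u x := congrFun hfu ⟨x, hx⟩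
  change max 0 (u x) = ‖f x‖ ^ 2
  rw [← h1, max_eq_right (sq_nonneg _)]

/-- The lower tail of the empirical norm of a single hypercontractive function. -/
lemma measure_empSq_le_half_le_exp [MeasurableSpace D] [MeasurableSpace E]
    [OpensMeasurableSpace E] (hT : 0 < T) {μ : Measure Ω} [IsProbabilityMeasure μ] {𝒳 : Set D}
    {X : Fin T → Ω → D} (hX : ∀ t, Measurable (X t)) (hX𝒳 : ∀ t ω, X t ω ∈ 𝒳) {f : D → E}
    (hf : Measurable (𝒳.domRestrict f)) {α C r : ℝ} (hα : 0 ≤ α) (hC : 0 < C) (hr : 0 < r)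
    (h2 : moment μ X 2 f = ENNReal.ofReal (r ^ 2))
    (h4 : moment μ X 4 f ≤ ENNReal.ofReal C * moment μ X 2 f ^ α) :
    μ {ω | empSq X f ω ≤ ENNReal.ofReal (r ^ 2 / 2)} ≤
      ENNReal.ofReal (Real.exp (-((T : ℝ) * r ^ (4 - 2 * α)) /
        (8 * C * opNorm (depMatrix (μ.map fun ω t => X t ω)) ^ 2))) := by
  have hT' : (0 : ℝ) < T := by exact_mod_cast hT
  obtain ⟨g, hg, hg0, hgf⟩ := exists_measurable_eqOn_norm_sq hf
  have hpath : Measurable fun ω t => X t ω := measurable_pi_lambda _ hX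
  set P := μ.map fun ω t => X t ω with hP
  have : IsProbabilityMeasure P := Measure.isProbabilityMeasure_map hpath.aemeasurable
  have hgX : ∀ t ω, ENNReal.ofReal (g (X t ω)) = ‖f (X t ω)‖ₑ ^ 2 := by
    intro t ω
    rw [hgf _ (hX𝒳 t ω), ENNReal.ofReal_pow (norm_nonneg _), ofReal_norm]
  have hgm : ∀ t : Fin T, Measurable fun z : Fin T → D => g (z t) := fun t =>
    hg.comp (measurable_pi_apply t)
  have hg2m : ∀ t : Fin T, Measurable fun z : Fin T → D => g (z t) ^ 2 := fun t =>
    (hgm t).pow_const 2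
  have e2 : (T : ℝ≥0∞)⁻¹ * ∑ t : Fin T, ∫⁻ z, ENNReal.ofReal (g (z t)) ∂P =
      ENNReal.ofReal (r ^ 2) := by
    rw [← h2, moment]
    congr 1
    refine Finset.sum_congr rfl fun t _ => ?_
    rw [hP, lintegral_map (hgm t).ennreal_ofReal hpath]
    simp_rw [hgX]
  have e4 : (T : ℝ≥0∞)⁻¹ * ∑ t : Fin T, ∫⁻ z, ENNReal.ofReal (g (z t) ^ 2) ∂P ≤
      ENNReal.ofReal (C * (r ^ 2) ^ α) := by
    rw [ENNReal.ofReal_mul hC.le, ← ENNReal.ofReal_rpow_of_nonneg (sq_nonneg r) hα, ← h2]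
    refine le_of_eq_of_le ?_ h4
    rw [moment]
    congr 1
    refine Finset.sum_congr rfl fun t _ => ?_
    rw [hP, lintegral_map (hg2m t).ennreal_ofReal hpath]
    simp_rw [ENNReal.ofReal_pow (hg0 _), hgX, ← pow_mul]
  obtain ⟨hi, hsum⟩ := integrable_and_sum_integral_eq hT hgm (fun t z => hg0 _)
    (by rw [e2]; exact ENNReal.ofReal_ne_top)
  obtain ⟨hi2, hsum2⟩ := integrable_and_sum_integral_eq hT hg2m (fun t z => sq_nonneg _)
    (ne_top_of_le_ne_top ENNReal.ofReal_ne_top e4)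
  rw [e2, ENNReal.toReal_ofReal (sq_nonneg r)] at hsum
  have hv : 0 < C * (r ^ 2) ^ α := by positivity
  have hsum2' : ∑ t : Fin T, ∫ z, g (z t) ^ 2 ∂P ≤ T * (C * (r ^ 2) ^ α) := by
    rw [hsum2]
    refine mul_le_mul_of_nonneg_left ?_ hT'.le
    exact ENNReal.toReal_le_of_le_ofReal hv.le e4
  have key := measureReal_sum_le_half_le_exp (P := P) hT hg hg0 hi hi2
    (m := T * r ^ 2) (v := T * (C * (r ^ 2) ^ α)) (by positivity) (by positivity) hsum.symm hsum2'
  have hset : {ω | empSq X f ω ≤ ENNReal.ofReal (r ^ 2 / 2)} =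
      (fun ω t => X t ω) ⁻¹' {z | ∑ t, g (z t) ≤ T * r ^ 2 / 2} := by
    ext ω
    simp only [mem_ofPred_eq, mem_preimage]
    rw [empSq_eq_ofReal hT, ENNReal.ofReal_le_ofReal_iff (by positivity), inv_mul_le_iff₀ hT',
      ← mul_div_assoc]
    simp_rw [← hgf _ (hX𝒳 _ ω)]
  have hmeas : MeasurableSet {z : Fin T → D | ∑ t, g (z t) ≤ T * r ^ 2 / 2} :=
    measurableSet_le (Finset.measurable_sum _ fun t _ => hgm t) measurable_const
  rw [hset, ← Measure.map_apply hpath hmeas, ← hP, ← ofReal_measureReal]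
  refine ENNReal.ofReal_le_ofReal (key.trans (Real.exp_le_exp.2 (le_of_eq ?_)))
  have hG : 0 < opNorm (depMatrix P) := opNorm_depMatrix_pos hT
  have hpow : r ^ (4 - 2 * α) = r ^ 4 / (r ^ 2) ^ α := by
    rw [Real.rpow_sub hr, Real.rpow_mul hr.le]
    norm_num [Real.rpow_ofNat]
  rw [hpow]
  have hrα : 0 < (r ^ 2) ^ α := by positivity
  field_simp

end Trajectory

end LowerIsometry

theorem mainTheorem4
    {Ω : Type*} [MeasurableSpace Ω] (μ : Measure Ω) [IsProbabilityMeasure μ]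
    (dx dy T : ℕ) (hT : 0 < T)
    -- the state space and the covariate process
    (𝒳 : Set (EuclideanSpace ℝ (Fin dx)))
    (X : Fin T → Ω → EuclideanSpace ℝ (Fin dx))
    (hX : ∀ t, Measurable (X t)) (hX𝒳 : ∀ t ω, X t ω ∈ 𝒳)
    -- the hypothesis class, the regression function, and the shifted class
    (F : Set (EuclideanSpace ℝ (Fin dx) → EuclideanSpace ℝ (Fin dy)))
    (hF : ∀ f ∈ F, Measurable (𝒳.domRestrict f))
    (fstar : EuclideanSpace ℝ (Fin dx) → EuclideanSpace ℝ (Fin dy)) (hfstar : fstar ∈ F)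
    (Fstar : Set (EuclideanSpace ℝ (Fin dx) → EuclideanSpace ℝ (Fin dy)))
    (hFstar : Fstar = F - {fstar})
    (hL2 : ∀ f ∈ Fstar, LowerIsometry.moment μ X 2 f < ∞)
    (hstar : StarConvex ℝ 0 Fstar)
    (α C r : ℝ) (hα : α ∈ Set.Icc (1 : ℝ) 2) (hC : 0 < C) (hr : 0 < r)
    (Fr : Set (EuclideanSpace ℝ (Fin dx) → EuclideanSpace ℝ (Fin dy)))
    (hnet : LowerIsometry.IsSupNet 𝒳 (r / √8) (LowerIsometry.sphere μ X Fstar r) Fr)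
    (hhyper : LowerIsometry.Hypercontractive μ X Fr C α) :
    μ {ω | ∃ f ∈ Fstar \ LowerIsometry.ball μ X Fstar r,
        LowerIsometry.empSq X f ω ≤ (1 / 8) * LowerIsometry.moment μ X 2 f} ≤
      (Fr.encard : ℝ≥0∞) * ENNReal.ofReal (Real.exp (-((T : ℝ) * r ^ (4 - 2 * α)) /
        (8 * C * (LowerIsometry.opNorm
          (LowerIsometry.depMatrix (μ.map (fun ω t => X t ω)))) ^ 2))) := by
  obtain ⟨hsub, hcover⟩ := hnet
  have hsingle : ∀ g ∈ Fr, μ {ω | LowerIsometry.empSq X g ω ≤ ENNReal.ofReal (r ^ 2 / 2)} ≤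
      ENNReal.ofReal (Real.exp (-((T : ℝ) * r ^ (4 - 2 * α)) /
        (8 * C * (LowerIsometry.opNorm
          (LowerIsometry.depMatrix (μ.map (fun ω t => X t ω)))) ^ 2))) := by
    intro g hg
    obtain ⟨hgF, hg2⟩ := hsub hg
    have hgm : Measurable (𝒳.domRestrict g) := by
      rw [hFstar] at hgF
      obtain ⟨f, hf, f', rfl, rfl⟩ := hgF
      exact (hF f hf).sub (hF _ hfstar)
    exact LowerIsometry.measure_empSq_le_half_le_exp hT hX hX𝒳 hgm (zero_le_one.trans hα.1) hC hr
      hg2 (hhyper g hg)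
  have hincl : {ω | ∃ f ∈ Fstar \ LowerIsometry.ball μ X Fstar r,
      LowerIsometry.empSq X f ω ≤ (1 / 8) * LowerIsometry.moment μ X 2 f} ⊆
      ⋃ g ∈ Fr, {ω | LowerIsometry.empSq X g ω ≤ ENNReal.ofReal (r ^ 2 / 2)} := by
    rintro ω ⟨f, hf, hω⟩
    obtain ⟨h, hh, hhω⟩ := LowerIsometry.exists_mem_sphere_empSq_le hstar hf (hL2 f hf.1) hω
    obtain ⟨g, hg, hgh⟩ := hcover h hh
    have hle := LowerIsometry.empSq_le_of_supNorm_le hT hX𝒳 (by positivity) hgh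
      (by positivity) hhω
    have hconst : 2 * (r ^ 2 / 8) + 2 * (r / √8) ^ 2 = r ^ 2 / 2 := by
      rw [div_pow, Real.sq_sqrt (by norm_num)]; ring
    rw [hconst] at hle
    exact mem_biUnion hg hle
  refine (measure_mono hincl).trans ?_
  rcases Fr.finite_or_infinite with hfin | hinf
  · obtain ⟨N, rfl⟩ := hfin.exists_finset_coe
    simp only [Finset.mem_coe, Set.encard_coe_eq_coe_finsetCard] at hsingle ⊢
    refine (measure_biUnion_finset_le N _).trans ((Finset.sum_le_sum hsingle).trans ?_)
    rw [Finset.sum_const, nsmul_eq_mul]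
    simp
  · rw [hinf.encard_eq, ENat.toENNReal_top, ENNReal.top_mul]
    · exact le_top
    · exact (ENNReal.ofReal_pos.2 (Real.exp_pos _)).ne'
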